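/- Let $\mathcal H=L^2(\mathbb R^2;\mathbb C^2)$, let $D\cdot\sigma=-i(\sigma_1\partial_x+\sigma_2\partial_y)$ be the massless Dirac operator on $\mathcal H$ with domain $\{\psi\in\mathcal H:(D\cdot\sigma)\psi\in\mathcal H \text{ in the sense of distributions}\}$, let $B$ be a bounded operator on $\mathcal H$ (for instance multiplication by a bounded $2\times2$ matrix-valued function), and let $\varepsilon>0$. Consider, on the domain of $D\cdot\sigma$, $$H(\tau)=D\cdot\sigma+\varepsilon\bigl(Be^{-i\tau}+B^*e^{i\tau}\bigr).$$ Let $U(\tau)$, $\tau\in\mathbb R$, be the evolution of $H(\tau)$, i.e. the family of bounded operators on $\mathcal H$ with $U(0)=I$ such that, for every $\psi\in\mathrm{Dom}(D\cdot\sigma)$, $U(\tau)\psi$ stays in $\mathrm{Dom}(D\cdot\sigma)$ and $i\partial_\tau U(\tau)\psi=H(\tau)U(\tau)\psi$. On $\widehat{\mathcal H}=L^2(\mathbb R^2;\ell^2(\mathbb Z)\otimes\mathbb C^2)\cong\ell^2(\mathbb Z;\mathcal H)$ let $\widehat H$ be the operator $$[\widehat H\varphi]_m=(m+D\cdot\sigma)\varphi_m+\varepsilon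 B\varphi_{m+1}+\varepsilon B^*\varphi_{m-1},\qquad m\in\mathbb Z,$$ on its maximal domain. For $n\ge0$ put $S_n=\{-n,\dots,n\}$, let $\mathcal E_{S_n}:\ell^2(S_n;\mathcal H)\to\widehat{\mathcal H}$ be the extension by zero, let $\widehat H_n=\mathcal E_{S_n}^*\widehat H\,\mathcal E_{S_n}$, and let $e^{-i\tau\widehat H_n}$ be the strongly continuous unitary group with generator $-i\widehat H_n$. For an operator $O$ on $\ell^2(S_n;\mathcal H)$ and $j,k\in S_n$ write $[O]_{jk}\psi=[O(e_k\otimes\psi)]_j$, where $e_k\otimes\psi$ is the family with entry $\psi$ at $k$ and $0$ elsewhere, and set $$U_n(\tau)=\sum_{k\in S_n}\bigl[e^{-i\tau\widehat H_n}\bigr]_{0k}.$$ Then the evolution $U$ exists and is unique, for every $n\ge0$ the unitary group $e^{-i\tau\widehat H_n}$ exists and is unique, and for all $n\ge0$ and all $\tau\ge0$, $$\|U(\tau)-U_n(\tau)\|_{\mathrm{op}}\le\frac{2}{(n+1)!}\bigl(2\|B\|_{\mathrm{op}}\,\varepsilon\,\tau\bigr)^{n+1}.$$ -/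

import Mathlib

open MeasureTheory
open scoped SchwartzMap LineDeriv ENNReal

namespace FloquetDirac

noncomputable section

/-- The spatial domain `ℝ²`. -/
abbrev Plane : Type := EuclideanSpace ℝ (Fin 2)

/-- The spinor space `ℂ²`. -/
abbrev Spinor : Type := EuclideanSpace ℂ (Fin 2)

/-- The Hilbert space `L²(ℝ²; ℂ²)`. -/
abbrev State : Type := Lp Spinor 2 (volume : Measure Plane)

/-- The Pauli matrix `σ₁`. -/
def sigma1 : Matrix (Fin 2) (Fin 2) ℂ := !![0, 1; 1, 0]

/-- The Pauli matrix `σ₂`. -/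
def sigma2 : Matrix (Fin 2) (Fin 2) ℂ := !![0, -Complex.I; Complex.I, 0]

/-- `D·σ = -i (σ₁ ∂ₓ + σ₂ ∂_y)` acting classically on Schwartz functions. -/
def diracSchwartz (φ : 𝓢(Plane, Spinor)) : 𝓢(Plane, Spinor) :=
  (-Complex.I) •
    (SchwartzMap.postcompCLM (𝕜 := ℂ) (Matrix.toEuclideanCLM (𝕜 := ℂ) sigma1)
        (∂_{EuclideanSpace.single (0 : Fin 2) (1 : ℝ)} φ) +
      SchwartzMap.postcompCLM (𝕜 := ℂ) (Matrix.toEuclideanCLM (𝕜 := ℂ) sigma2)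
        (∂_{EuclideanSpace.single (1 : Fin 2) (1 : ℝ)} φ))

/-- The pairs `(ψ, g)` in `L² × L²` with `(D·σ) ψ = g` in the sense of distributions: since `D·σ`
is formally self-adjoint, this reads `⟨(D·σ) φ, ψ⟩ = ⟨φ, g⟩` for all test functions `φ`. -/
def diracGraph : Submodule ℂ (State × State) where
  carrier := {p | ∀ φ : 𝓢(Plane, Spinor),
    inner ℂ ((diracSchwartz φ).toLp 2 : State) p.1 = inner ℂ (φ.toLp 2 : State) p.2}
  add_mem' := by
    intro p q hp hq φ
    simp only [Prod.fst_add, Prod.snd_add, inner_add_right]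
    rw [hp φ, hq φ]
  zero_mem' := by
    intro φ
    simp
  smul_mem' := by
    intro c p hp φ
    simp only [Prod.smul_fst, Prod.smul_snd, inner_smul_right]
    rw [hp φ]

theorem diracGraph_single_valued (p : State × State) (hp : p ∈ diracGraph) (h0 : p.1 = 0) :
    p.2 = 0 := by
  have hdense : DenseRange (SchwartzMap.toLpCLM ℝ Spinor 2 (volume : Measure Plane)) :=
    SchwartzMap.denseRange_toLpCLM (by norm_num)
  refine Dense.eq_zero_of_inner_left (𝕜 := ℂ) hdense ?_
  rintro v ⟨φ, rfl⟩
  have h := hp φ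
  rw [h0, inner_zero_right] at h
  rw [SchwartzMap.toLpCLM_apply, ← inner_conj_symm, ← h, map_zero]

/-- The massless Dirac operator `D·σ` on `L²(ℝ²; ℂ²)`, as an unbounded operator on the domain of
all `ψ ∈ L²` whose distributional `(D·σ) ψ` belongs to `L²`. -/
def dirac : State →ₗ.[ℂ] State := diracGraph.toLinearPMap

theorem dirac_graph : dirac.graph = diracGraph :=
  Submodule.toLinearPMap_graph_eq _ diracGraph_single_valued

/-- The driven Hamiltonian `H(τ) = D·σ + ε (B e^{-iτ} + B* e^{iτ})`, on the domain of `D·σ`. -/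
def drivenHamiltonian (B : State →L[ℂ] State) (ε τ : ℝ) : State →ₗ.[ℂ] State where
  domain := dirac.domain
  toFun := dirac.toFun +
    (((ε : ℂ) • (Complex.exp (-(Complex.I * τ)) • B +
      Complex.exp (Complex.I * τ) • ContinuousLinearMap.adjoint B) :
        State →L[ℂ] State) : State →ₗ[ℂ] State).comp dirac.domain.subtype

/-- `U` is the evolution of `H(τ)`: `U(0) = I` and `i ∂_τ U(τ) ψ = H(τ) U(τ) ψ` for every `ψ` in
the (time-independent) domain of `H(τ)`. -/
structure IsEvolution (B : State →L[ℂ] State) (ε : ℝ) (U : ℝ → State →L[ℂ] State) : Prop where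
  initial : U 0 = 1
  equation : ∀ ψ ∈ dirac.domain, ∀ τ : ℝ,
    ∃ h : U τ ψ ∈ (drivenHamiltonian B ε τ).domain,
      HasDerivAt (fun s : ℝ => U s ψ) (-Complex.I • drivenHamiltonian B ε τ ⟨U τ ψ, h⟩) τ

/-- The Hilbert space `L²(ℝ²; S ⊗ ℂ²)` of Fourier modes indexed by `S`, as the space of square
summable families of elements of `L²(ℝ²; ℂ²)`. -/
abbrev Modes (S : Type) : Type := lp (fun _ : S => State) 2

/-- The pairs `(φ, χ)` with `χ_n = (n + D·σ) φ_n + ε B φ_{n+1} + ε B* φ_{n-1}` for all `n : ℤ`. -/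
def floquetGraph (B : State →L[ℂ] State) (ε : ℝ) : Submodule ℂ (Modes ℤ × Modes ℤ) where
  carrier := {p | ∀ n : ℤ, ∃ h : p.1 n ∈ dirac.domain,
    p.2 n = (n : ℂ) • p.1 n + dirac ⟨p.1 n, h⟩ + (ε : ℂ) • B (p.1 (n + 1)) +
      (ε : ℂ) • ContinuousLinearMap.adjoint B (p.1 (n - 1))}
  add_mem' := by
    intro p q hp hq n
    obtain ⟨h₁, e₁⟩ := hp n
    obtain ⟨h₂, e₂⟩ := hq n
    refine ⟨dirac.domain.add_mem h₁ h₂, ?_⟩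
    have hd : dirac ⟨(p + q).1 n, dirac.domain.add_mem h₁ h₂⟩ =
        dirac ⟨p.1 n, h₁⟩ + dirac ⟨q.1 n, h₂⟩ := dirac.map_add ⟨p.1 n, h₁⟩ ⟨q.1 n, h₂⟩
    rw [hd]
    simp only [Prod.fst_add, Prod.snd_add, lp.coeFn_add, Pi.add_apply, e₁, e₂, map_add, smul_add]
    abel
  zero_mem' := by
    intro n
    refine ⟨dirac.domain.zero_mem, ?_⟩
    have hd : dirac ⟨(0 : Modes ℤ × Modes ℤ).1 n, dirac.domain.zero_mem⟩ = 0 := dirac.map_zero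
    rw [hd]
    simp
  smul_mem' := by
    intro c p hp n
    obtain ⟨h, e⟩ := hp n
    refine ⟨dirac.domain.smul_mem c h, ?_⟩
    have hd : dirac ⟨(c • p).1 n, dirac.domain.smul_mem c h⟩ = c • dirac ⟨p.1 n, h⟩ :=
      dirac.map_smul c ⟨p.1 n, h⟩
    rw [hd]
    simp only [Prod.smul_fst, Prod.smul_snd, lp.coeFn_smul, Pi.smul_apply, e, map_smul, smul_add,
      smul_comm c]

theorem floquetGraph_single_valued (B : State →L[ℂ] State) (ε : ℝ) (p : Modes ℤ × Modes ℤ)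
    (hp : p ∈ floquetGraph B ε) (h0 : p.1 = 0) : p.2 = 0 := by
  obtain ⟨φ, χ⟩ := p
  obtain rfl : φ = 0 := h0
  ext1
  funext n
  obtain ⟨h, e⟩ := hp n
  have hd : dirac ⟨(0 : Modes ℤ) n, h⟩ = 0 := dirac.map_zero
  simp only [hd] at e
  simpa using e

/-- The Floquet Hamiltonian `Ĥ`, with `[Ĥφ]_n = (n + D·σ) φ_n + ε B φ_{n+1} + ε B* φ_{n-1}`, on its
maximal domain. -/
def floquet (B : State →L[ℂ] State) (ε : ℝ) : Modes ℤ →ₗ.[ℂ] Modes ℤ :=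
  (floquetGraph B ε).toLinearPMap

theorem floquet_graph (B : State →L[ℂ] State) (ε : ℝ) :
    (floquet B ε).graph = floquetGraph B ε :=
  Submodule.toLinearPMap_graph_eq _ (floquetGraph_single_valued B ε)

open scoped Classical in
/-- Extension of a family indexed by `S` by zero to a family indexed by `ℤ`. -/
def extendZero (S : Set ℤ) (φ : S → State) (n : ℤ) : State :=
  if h : n ∈ S then φ ⟨n, h⟩ else 0

theorem hasSum_extendZero (S : Set ℤ) (φ : Modes S) :
    HasSum (fun n : ℤ => ‖extendZero S φ n‖ ^ (2 : ℝ)) (‖φ‖ ^ (2 : ℝ)) := by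
  have h := lp.hasSum_norm (p := 2) (by norm_num) φ
  rw [← Function.Injective.hasSum_iff (Subtype.val_injective (p := (· ∈ S)))]
  · have e : (fun n : ℤ => ‖extendZero S φ n‖ ^ (2 : ℝ)) ∘ (Subtype.val : S → ℤ) =
        fun n : S => ‖φ n‖ ^ (2 : ℝ) := by
      funext n
      simp [extendZero]
    rw [e]
    simpa using h
  · intro n hn
    have hn' : n ∉ S := by simpa using hn
    simp [extendZero, hn']

theorem norm_le_of_extendZero (S : Set ℤ) (φ : Modes S) (χ : Modes ℤ)
    (h : (χ : ℤ → State) = extendZero S φ) : ‖χ‖ = ‖φ‖ := by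
  have h₁ := lp.hasSum_norm (p := 2) (by norm_num) χ
  have h₂ := hasSum_extendZero S φ
  rw [h] at h₁
  rw [ENNReal.toReal_ofNat] at h₁
  exact (Real.rpow_left_inj (norm_nonneg _) (norm_nonneg _) (by norm_num)).1 (h₁.unique h₂)

/-- The embedding `𝓔_S` of the modes in `S` into all modes, `[𝓔_S φ]_n = φ_n` for `n ∈ S` and
`[𝓔_S φ]_n = 0` for `n ∉ S`. -/
def embed (S : Set ℤ) : Modes S →ₗᵢ[ℂ] Modes ℤ where
  toFun φ := ⟨extendZero S φ, memℓp_gen (by simpa using (hasSum_extendZero S φ).summable)⟩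
  map_add' φ χ := by
    ext1
    funext n
    change extendZero S (φ + χ : Modes S) n = extendZero S φ n + extendZero S χ n
    by_cases h : n ∈ S <;> simp [extendZero, h]
  map_smul' c φ := by
    ext1
    funext n
    change extendZero S (c • φ : Modes S) n = c • extendZero S φ n
    by_cases h : n ∈ S <;> simp [extendZero, h]
  norm_map' φ := norm_le_of_extendZero S φ _ rfl

/-- The truncated operator `Ĥ_S = 𝓔_S* Ĥ 𝓔_S`, on the domain of all `φ` with `𝓔_S φ ∈ Dom Ĥ`. -/
def replica (B : State →L[ℂ] State) (ε : ℝ) (S : Set ℤ) : Modes S →ₗ.[ℂ] Modes S where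
  domain := (floquet B ε).domain.comap (embed S).toLinearMap
  toFun := (ContinuousLinearMap.adjoint (embed S).toContinuousLinearMap).toLinearMap ∘ₗ
    (floquet B ε).toFun ∘ₗ (embed S).toLinearMap.restrict fun _ h => h

/-- `G` is the unitary group `t ↦ e^{-itA}`: a strongly continuous one-parameter unitary group
whose infinitesimal generator is exactly `-iA`, domain included. -/
structure IsUnitaryGroup {X : Type*} [NormedAddCommGroup X] [InnerProductSpace ℂ X]
    [CompleteSpace X] (A : X →ₗ.[ℂ] X) (G : ℝ → X →L[ℂ] X) : Prop where
  zero : G 0 = 1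
  add : ∀ s t : ℝ, G (s + t) = G s * G t
  unitary : ∀ t : ℝ, G t ∈ unitary (X →L[ℂ] X)
  continuous : ∀ x : X, Continuous fun t : ℝ => G t x
  generator : ∀ x y : X,
    (x, y) ∈ A.graph ↔ HasDerivAt (fun t : ℝ => G t x) (-Complex.I • y) 0

/-- The block `[O]_{nm} ψ = [O (e_m ⊗ ψ)]_n` of an operator `O` on families of modes. -/
def block {S : Type} [DecidableEq S] (O : Modes S →L[ℂ] Modes S) (n m : S) :
    State →L[ℂ] State :=
  lp.evalCLM ℂ (fun _ : S => State) 2 n ∘L O ∘L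
    lp.singleContinuousLinearMap ℂ (fun _ : S => State) 2 m

/-- The modes `S_n = {-n, …, n}` of the `(2n+1)`-replica model. -/
abbrev replicaSet (n : ℕ) : Set ℤ := Set.Icc (-(n : ℤ)) n

/-- The mode `0`, as an element of `S_n`. -/
def zeroMode (n : ℕ) : replicaSet n := ⟨0, by simp⟩

/-- The approximate evolution `U_n(τ) = ∑_{k ∈ S_n} [e^{-iτĤ_n}]_{0k}`, where `G` is the unitary
group `τ ↦ e^{-iτĤ_n}`. -/
def replicaEvolution (n : ℕ) (G : ℝ → Modes (replicaSet n) →L[ℂ] Modes (replicaSet n)) (τ : ℝ) :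
    State →L[ℂ] State :=
  ∑ k : replicaSet n, block (G τ) (zeroMode n) k

end

end FloquetDirac

open FloquetDirac

/-! Let `ψ(s) = U(s)x`. The modes `e^{-iks}ψ(s)`, `k ∈ ℤ`, formally solve `i∂φ = Ĥφ`: the phase
contributes the diagonal term `k`, and the factors `e^{∓is}` of the drive shift the mode index by
`±1`. At `s = 0` every mode equals `x`, which is why `U_n` sums over `k`, and the zero mode is
`ψ(s)` itself. Restricted to `S_n`, the modes solve the truncated equation up to a source `r(s)`
supported at `n` and `-n`, where one neighbour is missing; each part has norm at most `‖B‖ε‖x‖`.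

By Duhamel, the error is the integral over `t ∈ [0, τ]` of the zero component of `e^{-itĤ_n}r(τ-t)`,
up to a unimodular constant. A signal has to make `n` hops from `±n` to `0`. In the interaction
picture the diagonal part `m + D·σ` disappears and each hop costs one time integration with factor
`2‖B‖ε`, so the amplitude is at most `(2‖B‖εt)^n/n!` (`norm_apply_single_le`). Integrating once more
gives `(2‖B‖ετ)^{n+1}/(n+1)!` on the domain (`norm_evolution_sub_replicaEvolution_apply_le`), then
everywhere by density.

Well-posedness rests on self-adjointness. `D·σ ± i` maps Schwartz space onto itself because `(D·σ)²
= -Δ`, so the maximal Dirac operator is self-adjoint (`isSelfAdjointGraph_dirac`); a finite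
truncation adds only bounded symmetric terms to copies of it (`isSelfAdjointGraph_replica`). Stone's
theorem (`exists_isUnitaryGroup`) gives the groups, and a Dyson series in the interaction picture
gives `U`; the drive being Lipschitz in time keeps the domain invariant (`exists_isPropagator`). -/

open Filter Topology

namespace FloquetDirac

/-! ### Growth of curves in an inner product space -/

section Analysis

variable {X : Type*} [NormedAddCommGroup X] [InnerProductSpace ℂ X]

/-- A curve whose radial velocity is at most `K` stays within `K * |t|` of its initial norm. -/
theorem norm_le_add_of_abs_re_inner_le {f f' : ℝ → X} {K : ℝ} (hKn : 0 ≤ K)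
    (hf : ∀ t, HasDerivAt f (f' t) t)
    (hK : ∀ t, |(inner ℂ (f t) (f' t)).re| ≤ K * ‖f t‖) (t : ℝ) :
    ‖f t‖ ≤ ‖f 0‖ + K * |t| := by
  -- The norm need not be differentiable at zeros of `f`; the smooth substitute `√(‖f‖² + δ²)` has
  -- slope at most `K`, and `δ` is arbitrary.
  refine le_of_forall_pos_le_add fun δ hδ => ?_
  have hpos : ∀ s, 0 < ‖f s‖ ^ 2 + δ ^ 2 := fun s => by positivity
  have hg : ∀ s, HasDerivAt (fun s => √(‖f s‖ ^ 2 + δ ^ 2))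
      ((inner ℂ (f s) (f' s)).re / √(‖f s‖ ^ 2 + δ ^ 2)) s := by
    intro s
    have h1 : HasDerivAt (fun s => ‖f s‖ ^ 2) (2 * (inner ℂ (f s) (f' s)).re) s := by
      let _ : InnerProductSpace ℝ X := InnerProductSpace.rclikeToReal ℂ X
      exact (hf s).norm_sq
    convert (h1.add_const (δ ^ 2)).sqrt (hpos s).ne' using 1
    field_simp
  have hbound : ∀ s, ‖(inner ℂ (f s) (f' s)).re / √(‖f s‖ ^ 2 + δ ^ 2)‖ ≤ K := by
    intro s
    rw [norm_div, Real.norm_eq_abs, Real.norm_eq_abs, abs_of_pos (Real.sqrt_pos.2 (hpos s)),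
      div_le_iff₀ (Real.sqrt_pos.2 (hpos s))]
    refine (hK s).trans (mul_le_mul_of_nonneg_left ?_ hKn)
    exact Real.le_sqrt_of_sq_le (by nlinarith [sq_nonneg δ])
  have hmv := convex_univ.norm_image_sub_le_of_norm_hasDerivWithin_le (C := K)
    (fun s _ => (hg s).hasDerivWithinAt) (fun s _ => hbound s) (Set.mem_univ 0) (Set.mem_univ t)
  have h1 : ‖f t‖ ≤ √(‖f t‖ ^ 2 + δ ^ 2) := Real.le_sqrt_of_sq_le (by nlinarith [sq_nonneg δ])
  have h2 : √(‖f 0‖ ^ 2 + δ ^ 2) ≤ ‖f 0‖ + δ :=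
    Real.sqrt_le_iff.2 ⟨by positivity, by nlinarith [norm_nonneg (f 0)]⟩
  have h3 := (le_abs_self _).trans hmv
  simp only [sub_zero, Real.norm_eq_abs] at h3
  linarith

end Analysis

/-! ### Strongly continuous, uniformly bounded operator families -/

section Contractions

variable {X Y : Type*} [NormedAddCommGroup X] [NormedSpace ℂ X] [NormedAddCommGroup Y]
  [NormedSpace ℂ Y]

theorem tendsto_apply_of_norm_le {ι : Type*} {l : Filter ι} {L : ι → X →L[ℂ] Y} {L₀ : X →L[ℂ] Y}
    {a : ι → X} {a₀ : X} {K : ℝ} (hK : ∀ i, ‖L i‖ ≤ K) (hL : Tendsto (fun i => L i a₀) l (𝓝 (L₀ a₀)))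
    (ha : Tendsto a l (𝓝 a₀)) : Tendsto (fun i => L i (a i)) l (𝓝 (L₀ a₀)) := by
  have h : Tendsto (fun i => L i (a i - a₀)) l (𝓝 0) := by
    refine squeeze_zero_norm (a := fun i => K * ‖a i - a₀‖) (fun i => (L i).le_of_opNorm_le (hK i) _) ?_
    simpa using (tendsto_iff_norm_sub_tendsto_zero.1 ha).const_mul K
  simpa using h.add hL

/-- Product rule for a uniformly bounded, strongly continuous family of operators. -/
theorem hasDerivAt_clm_apply_of_norm_le {L : ℝ → X →L[ℂ] Y} {f : ℝ → X} {s : ℝ} {l' : Y} {f' : X}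
    {K : ℝ} (hK : ∀ t, ‖L t‖ ≤ K) (hc : ContinuousAt (fun t => L t f') s)
    (hL : HasDerivAt (fun t => L t (f s)) l' s) (hf : HasDerivAt f f' s) :
    HasDerivAt (fun t => L t (f t)) (l' + L s f') s := by
  rw [hasDerivAt_iff_tendsto_slope] at *
  have h1 : Tendsto (fun t => L t (slope f s t)) (𝓝[≠] s) (𝓝 (L s f')) :=
    tendsto_apply_of_norm_le hK (hc.tendsto.mono_left nhdsWithin_le_nhds) hf
  refine (hL.add h1).congr fun t => ?_
  simp only [slope, vsub_eq_sub]
  rw [← Complex.coe_smul, ← Complex.coe_smul, ← Complex.coe_smul, map_smul, ← smul_add, map_sub]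
  congr 1
  abel

end Contractions

/-! ### Calculus along a unitary group -/

section UnitaryGroup

variable {X : Type*} [NormedAddCommGroup X] [InnerProductSpace ℂ X] [CompleteSpace X]
  {A : X →ₗ.[ℂ] X} {G : ℝ → X →L[ℂ] X}

theorem IsUnitaryGroup.norm_apply (hG : IsUnitaryGroup A G) (t : ℝ) (x : X) : ‖G t x‖ = ‖x‖ :=
  ContinuousLinearMap.norm_map_of_mem_unitary (hG.unitary t) x

theorem IsUnitaryGroup.norm_le (hG : IsUnitaryGroup A G) (t : ℝ) : ‖G t‖ ≤ 1 :=
  (G t).opNorm_le_bound zero_le_one fun x => by rw [hG.norm_apply, one_mul]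

theorem IsUnitaryGroup.apply_apply (hG : IsUnitaryGroup A G) (s t : ℝ) (x : X) :
    G s (G t x) = G (s + t) x := by
  rw [hG.add]; rfl

theorem IsUnitaryGroup.apply_neg_apply (hG : IsUnitaryGroup A G) (t : ℝ) (x : X) :
    G t (G (-t) x) = x := by
  rw [hG.apply_apply, add_neg_cancel, hG.zero]; rfl

theorem IsUnitaryGroup.neg_apply_apply (hG : IsUnitaryGroup A G) (t : ℝ) (x : X) :
    G (-t) (G t x) = x := by
  rw [hG.apply_apply, neg_add_cancel, hG.zero]; rfl

theorem IsUnitaryGroup.adjoint_eq (hG : IsUnitaryGroup A G) (t : ℝ) :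
    ContinuousLinearMap.adjoint (G t) = G (-t) := by
  ext x
  have h : ContinuousLinearMap.adjoint (G t) * G t = 1 := (Unitary.mem_iff.1 (hG.unitary t)).1
  calc ContinuousLinearMap.adjoint (G t) x
      = (ContinuousLinearMap.adjoint (G t) * G t) (G (-t) x) := by
        simp [hG.apply_neg_apply]
    _ = G (-t) x := by rw [h]; rfl

theorem IsUnitaryGroup.inner_apply_left (hG : IsUnitaryGroup A G) (t : ℝ) (x y : X) :
    inner ℂ (G t x) y = inner ℂ x (G (-t) y) := by
  rw [← hG.adjoint_eq, ContinuousLinearMap.adjoint_inner_right]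

theorem IsUnitaryGroup.hasDerivAt (hG : IsUnitaryGroup A G) {x y : X} (h : (x, y) ∈ A.graph)
    (t : ℝ) : HasDerivAt (fun s => G s x) (-Complex.I • G t y) t := by
  have h0 := (hG.generator x y).1 h
  have h1 : HasDerivAt (fun s => G (s - t) x) (-Complex.I • y) t := by
    have := HasDerivAt.comp_sub_const (f := fun s => G s x) t t (by simpa using h0)
    simpa using this
  have h2 := ((G t).restrictScalars ℝ).hasFDerivAt.comp_hasDerivAt t h1
  simp only [ContinuousLinearMap.coe_restrictScalars', map_smul] at h2
  refine h2.congr_of_eventuallyEq (Eventually.of_forall fun s => ?_)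
  simp [hG.apply_apply]

theorem IsUnitaryGroup.apply_mem_graph (hG : IsUnitaryGroup A G) {x y : X}
    (h : (x, y) ∈ A.graph) (t : ℝ) : (G t x, G t y) ∈ A.graph := by
  rw [hG.generator]
  have h2 := ((G t).restrictScalars ℝ).hasFDerivAt.comp_hasDerivAt 0 ((hG.generator x y).1 h)
  simp only [ContinuousLinearMap.coe_restrictScalars', map_smul] at h2
  refine h2.congr_of_eventuallyEq (Eventually.of_forall fun s => ?_)
  simp [hG.apply_apply, add_comm]

/-- Product rule along a strongly continuous unitary group. -/
theorem IsUnitaryGroup.hasDerivAt_apply (hG : IsUnitaryGroup A G) {f : ℝ → X} {f' y : X} {s : ℝ}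
    (c d : ℝ) (hf : HasDerivAt f f' s) (hy : (f s, y) ∈ A.graph) :
    HasDerivAt (fun t => G (c * t + d) (f t))
      (G (c * s + d) (f' - (c * Complex.I) • y)) s := by
  have h1 : HasDerivAt (fun t => G (c * t + d) (f s))
      (c • (-Complex.I • G (c * s + d) y)) s := by
    have h2 : HasDerivAt (fun t : ℝ => c * t + d) c s := by
      simpa using ((hasDerivAt_id s).const_mul c).add_const d
    exact (hG.hasDerivAt hy (c * s + d)).scomp s h2
  have h3 := hasDerivAt_clm_apply_of_norm_le (L := fun t => G (c * t + d)) (fun t => hG.norm_le _)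
    ((hG.continuous f').comp (by fun_prop : Continuous fun t : ℝ => c * t + d)).continuousAt h1 hf
  convert h3 using 1
  rw [map_sub, map_smul, ← Complex.coe_smul, smul_smul, sub_eq_neg_add, ← neg_smul]
  simp

theorem norm_sub_le_of_mem_graph (hG : IsUnitaryGroup A G) {x y : X} (h : (x, y) ∈ A.graph)
    (t : ℝ) : ‖G t x - x‖ ≤ ‖y‖ * |t| := by
  have hmv := convex_univ.norm_image_sub_le_of_norm_hasDerivWithin_le (C := ‖y‖)
    (fun s _ => (hG.hasDerivAt h s).hasDerivWithinAt)
    (fun s _ => by simp [norm_smul, hG.norm_apply]) (Set.mem_univ 0) (Set.mem_univ t)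
  simpa [hG.zero] using hmv

end UnitaryGroup

/-! ### Self-adjoint relations, resolvents and Yosida approximation -/

section SelfAdjointGraph

variable {X : Type*} [NormedAddCommGroup X] [InnerProductSpace ℂ X]

/-- A linear relation that coincides with its adjoint relation. -/
def IsSelfAdjointGraph (Γ : Submodule ℂ (X × X)) : Prop :=
  ∀ x y, (x, y) ∈ Γ ↔ ∀ u v, (u, v) ∈ Γ → inner ℂ v x = inner ℂ u y

variable {Γ : Submodule ℂ (X × X)}

theorem IsSelfAdjointGraph.inner_eq (hΓ : IsSelfAdjointGraph Γ) {x y u v : X} (h : (x, y) ∈ Γ)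
    (h' : (u, v) ∈ Γ) : inner ℂ v x = inner ℂ u y :=
  (hΓ x y).1 h u v h'

theorem IsSelfAdjointGraph.inner_im (hΓ : IsSelfAdjointGraph Γ) {x y : X} (h : (x, y) ∈ Γ) :
    (inner ℂ x y).im = 0 := by
  have h1 := hΓ.inner_eq h h
  rw [← inner_conj_symm] at h1
  exact Complex.conj_eq_iff_im.1 h1

theorem IsSelfAdjointGraph.re_inner_neg_I_smul (hΓ : IsSelfAdjointGraph Γ) {x y : X}
    (h : (x, y) ∈ Γ) : (inner ℂ x (-Complex.I • y)).re = 0 := by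
  simp [inner_smul_right, hΓ.inner_im h]

theorem IsSelfAdjointGraph.isClosed (hΓ : IsSelfAdjointGraph Γ) : IsClosed (Γ : Set (X × X)) := by
  have : (Γ : Set (X × X)) =
      ⋂ (u : X) (v : X) (_ : (u, v) ∈ Γ), {p : X × X | inner ℂ v p.1 = inner ℂ u p.2} := by
    ext ⟨x, y⟩
    simpa using hΓ x y
  rw [this]
  refine isClosed_iInter fun u => isClosed_iInter fun v => isClosed_iInter fun _ => ?_
  exact isClosed_eq (by fun_prop) (by fun_prop)

/-- The map `(x, y) ↦ y + c x`. -/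
def shiftMap (c : ℂ) : X × X →L[ℂ] X :=
  ContinuousLinearMap.snd ℂ X X + c • ContinuousLinearMap.fst ℂ X X

theorem shiftMap_apply (c : ℂ) (p : X × X) : shiftMap c p = p.2 + c • p.1 := rfl

/-- The cross term is the real part of a purely imaginary number. This identity is the source of the
injectivity, closed range and resolvent bound below. -/
theorem norm_sq_add_I_smul {x y : X} (h : (inner ℂ x y).im = 0) (r : ℝ) :
    ‖y + ((r : ℂ) * Complex.I) • x‖ ^ 2 = ‖y‖ ^ 2 + r ^ 2 * ‖x‖ ^ 2 := by
  have h' : (inner ℂ y x).im = 0 := by rw [← inner_conj_symm, Complex.conj_im, h, neg_zero]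
  rw [@norm_add_sq ℂ, inner_smul_right, norm_smul]
  simp [h', mul_pow]

theorem antilipschitz_shiftMap (hΓ : ∀ p ∈ Γ, (inner ℂ p.1 p.2).im = 0) {r : ℝ} (hr : r ≠ 0) :
    ∃ K : NNReal, AntilipschitzWith K (shiftMap ((r : ℂ) * Complex.I) ∘L Γ.subtypeL) := by
  refine ⟨⟨1 + |r|⁻¹, by positivity⟩, AddMonoidHomClass.antilipschitz_of_bound _ fun p => ?_⟩
  have h := norm_sq_add_I_smul (hΓ p p.2) r
  set N := ‖(p : X × X).2 + ((r : ℂ) * Complex.I) • (p : X × X).1‖ with hN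
  have hr' : 0 < |r| := abs_pos.2 hr
  have h1 : ‖(p : X × X).2‖ ≤ N :=
    abs_le_of_sq_le_sq' (by nlinarith [sq_nonneg (r * ‖(p : X × X).1‖)]) (norm_nonneg _) |>.2
  have h2 : |r| * ‖(p : X × X).1‖ ≤ N :=
    abs_le_of_sq_le_sq' (by rw [mul_pow, sq_abs]; nlinarith [sq_nonneg (‖(p : X × X).2‖)])
      (norm_nonneg _) |>.2
  change ‖(p : X × X)‖ ≤ (1 + |r|⁻¹) * N
  have h3 : ‖(p : X × X).1‖ ≤ |r|⁻¹ * N := by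
    rw [inv_mul_eq_div, le_div_iff₀ hr']; linarith
  have h4 : 0 ≤ |r|⁻¹ * N := by positivity
  have h5 : 0 ≤ N := norm_nonneg _
  exact max_le (by linarith) (by linarith)

theorem isClosed_range_shiftMap [CompleteSpace X] (hc : IsClosed (Γ : Set (X × X)))
    (hΓ : ∀ p ∈ Γ, (inner ℂ p.1 p.2).im = 0) {r : ℝ} (hr : r ≠ 0) :
    IsClosed (Set.range (shiftMap ((r : ℂ) * Complex.I) ∘L Γ.subtypeL)) := by
  obtain ⟨K, hK⟩ := antilipschitz_shiftMap hΓ hr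
  have : CompleteSpace Γ := hc.completeSpace_coe
  exact hK.isClosed_range (ContinuousLinearMap.uniformContinuous _)

/-- A closed range with trivial orthogonal complement is everything. Self-adjointness is not
assumed, so that this also applies to the closure of a symmetric relation. -/
theorem surjective_shiftMap_of_orthogonal [CompleteSpace X] (hc : IsClosed (Γ : Set (X × X)))
    (hΓ : ∀ p ∈ Γ, (inner ℂ p.1 p.2).im = 0) {r : ℝ} (hr : r ≠ 0)
    (h0 : ∀ z : X, (∀ p ∈ Γ, inner ℂ (shiftMap ((r : ℂ) * Complex.I) p) z = 0) → z = 0) (z : X) :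
    ∃ p ∈ Γ, shiftMap ((r : ℂ) * Complex.I) p = z := by
  set L := shiftMap ((r : ℂ) * Complex.I) ∘L Γ.subtypeL with hL
  have hcl : IsClosed ((LinearMap.range L.toLinearMap : Submodule ℂ X) : Set X) :=
    isClosed_range_shiftMap hc hΓ hr
  have htop : (LinearMap.range L.toLinearMap).topologicalClosure = ⊤ := by
    rw [Submodule.topologicalClosure_eq_top_iff, Submodule.eq_bot_iff]
    intro z hz
    refine h0 z fun p hp => ?_
    exact (Submodule.mem_orthogonal _ _).1 hz _ ⟨⟨p, hp⟩, rfl⟩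
  rw [hcl.submodule_topologicalClosure_eq] at htop
  obtain ⟨⟨p, hp⟩, h⟩ : z ∈ LinearMap.range L.toLinearMap := htop ▸ Submodule.mem_top
  exact ⟨p, hp, h⟩

theorem IsSelfAdjointGraph.exists_add_smul_eq [CompleteSpace X] (hΓ : IsSelfAdjointGraph Γ) {r : ℝ}
    (hr : r ≠ 0) (z : X) : ∃ p ∈ Γ, shiftMap ((r : ℂ) * Complex.I) p = z := by
  refine surjective_shiftMap_of_orthogonal hΓ.isClosed (fun p hp => hΓ.inner_im hp) hr
    (fun z hz => ?_) z
  -- A vector orthogonal to the range is an eigenvector with eigenvalue `ir`, which contradicts the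
  -- reality of `⟨x, y⟩` on `Γ` unless it vanishes.
  have hz' : (z, ((r : ℂ) * Complex.I) • z) ∈ Γ := by
    refine (hΓ _ _).2 fun u v huv => ?_
    have := hz _ huv
    simp only [shiftMap_apply, inner_add_left, inner_smul_left] at this
    simp only [inner_smul_right]
    have e : (starRingEnd ℂ) ((r : ℂ) * Complex.I) = -((r : ℂ) * Complex.I) := by simp
    rw [e] at this
    linear_combination this
  have h := hΓ.inner_im hz'
  simp only [inner_smul_right, inner_self_eq_norm_sq_to_K] at h
  have h2 : r * ‖z‖ ^ 2 = 0 := by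
    simpa [← Complex.ofReal_pow] using h
  simpa [hr] using h2

/-- The resolvent of a self-adjoint graph at a non-real point of the imaginary axis. -/
theorem IsSelfAdjointGraph.exists_resolvent [CompleteSpace X] (hΓ : IsSelfAdjointGraph Γ) {r : ℝ}
    (hr : r ≠ 0) : ∃ R : X →L[ℂ] X, ‖R‖ ≤ |r|⁻¹ ∧
      (∀ z, (R z, z - ((r : ℂ) * Complex.I) • R z) ∈ Γ) ∧
      ∀ x y, (x, y) ∈ Γ → R (y + ((r : ℂ) * Complex.I) • x) = x := by
  have hbound : ∀ p ∈ Γ, |r| * ‖p.1‖ ≤ ‖shiftMap ((r : ℂ) * Complex.I) p‖ := fun p hp => by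
    have h := norm_sq_add_I_smul (hΓ.inner_im hp) r
    refine abs_le_of_sq_le_sq' ?_ (norm_nonneg _) |>.2
    rw [shiftMap_apply, h, mul_pow, sq_abs]
    nlinarith [sq_nonneg ‖p.2‖]
  have hinj : ∀ p ∈ Γ, ∀ q ∈ Γ, shiftMap ((r : ℂ) * Complex.I) p = shiftMap ((r : ℂ) * Complex.I) q →
      p.1 = q.1 := fun p hp q hq h => by
    have := hbound (p - q) (Γ.sub_mem hp hq)
    rw [map_sub, h, sub_self, norm_zero] at this
    have h2 : ‖(p - q).1‖ ≤ 0 := by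
      by_contra hcon
      push Not at hcon
      nlinarith [abs_pos.2 hr]
    simpa [sub_eq_zero] using h2
  choose P hP hPz using fun z => hΓ.exists_add_smul_eq hr z
  let R : X →ₗ[ℂ] X :=
    { toFun := fun z => (P z).1
      map_add' := fun a b => hinj _ (hP _) _ (Γ.add_mem (hP a) (hP b)) (by simp [hPz])
      map_smul' := fun c a => hinj _ (hP _) _ (Γ.smul_mem c (hP a)) (by simp [hPz]) }
  refine ⟨R.mkContinuous |r|⁻¹ fun z => ?_, R.mkContinuous_norm_le (by positivity) _, fun z => ?_, fun x y h => ?_⟩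
  · have := hbound _ (hP z)
    rw [hPz] at this
    rw [inv_mul_eq_div, le_div_iff₀ (abs_pos.2 hr), mul_comm]
    exact this
  · have : ((P z).1, z - ((r : ℂ) * Complex.I) • (P z).1) = P z := by
      ext
      · rfl
      · have := hPz z
        rw [shiftMap_apply] at this
        exact sub_eq_of_eq_add this.symm
    change ((P z).1, z - ((r : ℂ) * Complex.I) • (P z).1) ∈ Γ
    rw [this]
    exact hP z
  · exact hinj _ (hP _) _ h (by rw [hPz]; rfl)

/-- If `z` is orthogonal to the domain, then `(0, z)` satisfies the adjoint condition, hence lies in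
`Γ`, and single-valuedness kills it. -/
theorem IsSelfAdjointGraph.dense_fst [CompleteSpace X] (hΓ : IsSelfAdjointGraph Γ)
    (h0 : ∀ y, (0, y) ∈ Γ → y = 0) : Dense {x | ∃ y, (x, y) ∈ Γ} := by
  have h : Dense ((Γ.map (LinearMap.fst ℂ X X) : Submodule ℂ X) : Set X) := by
    rw [Submodule.dense_iff_topologicalClosure_eq_top, Submodule.topologicalClosure_eq_top_iff, Submodule.eq_bot_iff]
    intro z hz
    refine h0 z ((hΓ _ _).2 fun u v huv => ?_)
    rw [inner_zero_right, (Submodule.mem_orthogonal _ _).1 hz u ⟨_, huv, rfl⟩]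
  refine h.mono ?_
  rintro _ ⟨⟨x, y⟩, h, rfl⟩
  exact ⟨y, h⟩

/-- On the domain `icRx = x - Ry` with `Ry → 0`; the bound `‖icR‖ ≤ 1` carries the limit to all
vectors by density. -/
theorem IsSelfAdjointGraph.tendsto_resolvent [CompleteSpace X] (hΓ : IsSelfAdjointGraph Γ)
    (h0 : ∀ y, (0, y) ∈ Γ → y = 0) {c : ℕ → ℝ} (hc : Tendsto (fun n => |c n|) atTop atTop)
    {R : ℕ → X →L[ℂ] X} (hR : ∀ n, ‖R n‖ ≤ |c n|⁻¹)
    (hRx : ∀ n, ∀ x y, (x, y) ∈ Γ → R n (y + ((c n : ℂ) * Complex.I) • x) = x) (z : X) :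
    Tendsto (fun n => ((c n : ℂ) * Complex.I) • R n z) atTop (𝓝 z) := by
  have hinv : Tendsto (fun n => |c n|⁻¹) atTop (𝓝 0) := tendsto_inv_atTop_zero.comp hc
  have hle : ∀ n w, ‖((c n : ℂ) * Complex.I) • R n w‖ ≤ ‖w‖ := fun n w => by
    have h1 := (R n).le_of_opNorm_le (hR n) w
    rw [norm_smul, norm_mul, Complex.norm_I, mul_one, Complex.norm_real, Real.norm_eq_abs]
    rcases eq_or_ne (c n) 0 with h | h
    · simp [h]
    · calc |c n| * ‖R n w‖ ≤ |c n| * (|c n|⁻¹ * ‖w‖) := by gcongr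
        _ = ‖w‖ := by rw [← mul_assoc, mul_inv_cancel₀ (abs_ne_zero.2 h), one_mul]
  rw [Metric.tendsto_atTop]
  intro ε hε
  obtain ⟨x, ⟨y, hxy⟩, hx⟩ := (hΓ.dense_fst h0).exists_dist_lt z (by positivity : 0 < ε / 3)
  have hlim : Tendsto (fun n => ‖R n y‖) atTop (𝓝 0) := by
    refine squeeze_zero (fun n => norm_nonneg _) (fun n => (R n).le_of_opNorm_le (hR n) y) ?_
    simpa using hinv.mul_const ‖y‖
  obtain ⟨N, hN⟩ := Metric.tendsto_atTop.1 hlim (ε / 3) (by positivity)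
  refine ⟨N, fun n hn => ?_⟩
  have h1 : ((c n : ℂ) * Complex.I) • R n x = x - R n y := by
    rw [eq_sub_iff_add_eq', ← map_smul, ← map_add, hRx n x y hxy]
  have h2 := hN n hn
  rw [Real.dist_eq, sub_zero, abs_norm] at h2
  have h3 : ((c n : ℂ) * Complex.I) • R n z - z =
      ((c n : ℂ) * Complex.I) • R n (z - x) - R n y - (z - x) := by
    rw [map_sub, smul_sub, h1]; abel
  rw [dist_eq_norm, h3]
  rw [dist_eq_norm] at hx
  calc _ ≤ ‖((c n : ℂ) * Complex.I) • R n (z - x)‖ + ‖R n y‖ + ‖z - x‖ :=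
        (norm_sub_le _ _).trans (by gcongr; exact norm_sub_le _ _)
    _ < ε := by linarith [hle n (z - x)]

/-- The symmetric Yosida approximation: a self-adjoint operator is a strong limit, on its domain, of
commuting bounded self-adjoint operators. -/
theorem IsSelfAdjointGraph.exists_approx [CompleteSpace X] (hΓ : IsSelfAdjointGraph Γ)
    (h0 : ∀ y, (0, y) ∈ Γ → y = 0) : ∃ a : ℕ → X →L[ℂ] X,
      (∀ n x y, inner ℂ (a n x) y = inner ℂ x (a n y)) ∧ (∀ m n, Commute (a m) (a n)) ∧
      ∀ x y, (x, y) ∈ Γ → Tendsto (fun n => a n x) atTop (𝓝 y) := by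
  choose R hR hRm hRx using fun (r : ℝ) (hr : r ≠ 0) => hΓ.exists_resolvent hr
  have hinner : ∀ r hr z w, inner ℂ (R r hr z) w = inner ℂ z (R (-r) (neg_ne_zero.2 hr) w) := by
    intro r hr z w
    have h := hΓ.inner_eq (hRm _ (neg_ne_zero.2 hr) w) (hRm r hr z)
    rw [inner_sub_left, inner_sub_right, inner_smul_left, inner_smul_right] at h
    simp only [map_mul, Complex.conj_ofReal, Complex.conj_I, Complex.ofReal_neg] at h
    linear_combination -h
  have hcomm : ∀ r hr s hs, Commute (R r hr) (R s hs) := by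
    intro r hr s hs
    -- First resolvent identity. Adding its copy with `r` and `s` exchanged leaves `(r - s)i[R_r,
    -- R_s] = 0`.
    have key : ∀ r hr s hs z, R s hs z = R r hr z +
        (((r : ℂ) - s) * Complex.I) • R r hr (R s hs z) := fun r hr s hs z => by
      have h := hRx r hr _ _ (hRm s hs z)
      rw [← map_smul, ← map_add]
      rw [← h]
      congr 1
      rw [h]
      module
    rcases eq_or_ne r s with rfl | hne
    · exact Commute.refl _
    ext z
    have h1 := key r hr s hs z
    have h2 := key s hs r hr z
    have h3 : (((r : ℂ) - s) * Complex.I) • (R r hr (R s hs z) - R s hs (R r hr z)) = 0 := by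
      have e : (((s : ℂ) - r) * Complex.I) = -(((r : ℂ) - s) * Complex.I) := by ring
      rw [e, neg_smul] at h2
      rw [smul_sub, sub_eq_zero]
      have h4 := congrArg₂ (· + ·) h1 h2
      have h5 := sub_eq_zero.2 h4
      rw [← sub_eq_zero, ← neg_eq_zero, ← h5]
      abel
    have h4 : (((r : ℂ) - s) * Complex.I) ≠ 0 :=
      mul_ne_zero (sub_ne_zero.2 (by exact_mod_cast hne)) Complex.I_ne_zero
    exact sub_eq_zero.1 ((smul_eq_zero.1 h3).resolve_left h4)
  have hp : ∀ n : ℕ, (n : ℝ) + 1 ≠ 0 := fun n => by positivity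
  have hq : ∀ n : ℕ, -((n : ℝ) + 1) ≠ 0 := fun n => neg_ne_zero.2 (hp n)
  have htop : Tendsto (fun n : ℕ => (n : ℝ) + 1) atTop atTop :=
    tendsto_atTop_add_const_right _ _ tendsto_natCast_atTop_atTop
  -- With `c = n + 1` and `R_r = (A + ir)⁻¹`, this is `c²A/(A² + c²)`; it is symmetric because `R_c`
  -- and `R_{-c}` are adjoint to each other.
  refine ⟨fun n => ((((n : ℝ) + 1) ^ 2 / 2 : ℝ) : ℂ) • (R _ (hp n) + R _ (hq n)), ?_, ?_, ?_⟩
  · intro n x y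
    have h2 := hinner _ (hq n) x y
    simp only [neg_neg] at h2
    simp only [smul_apply, add_apply, inner_smul_left,
      inner_smul_right, inner_add_left, inner_add_right, Complex.conj_ofReal, h2, hinner _ (hp n) x y]
    ring
  · intro m n
    refine Commute.smul_left (Commute.smul_right ?_ _) _
    exact ((hcomm _ _ _ _).add_left (hcomm _ _ _ _)).add_right
      ((hcomm _ _ _ _).add_left (hcomm _ _ _ _))
  · intro x y hxy
    have l1 := hΓ.tendsto_resolvent h0 (tendsto_abs_atTop_atTop.comp htop)
      (fun n => hR _ (hp n)) (fun n => hRx _ (hp n)) y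
    have l2 := hΓ.tendsto_resolvent h0
      ((tendsto_abs_atTop_atTop.comp htop).congr fun n => (abs_neg _).symm)
      (fun n => hR _ (hq n)) (fun n => hRx _ (hq n)) y
    -- On the domain, the approximant at `x` equals the half-sum of `icR_c y` and `-icR_{-c} y`: the
    -- terms `±icx` cancel.
    have l3 := (l1.add l2).const_smul (1 / 2 : ℂ)
    have e : (1 / 2 : ℂ) • (y + y) = y := by module
    rw [e] at l3
    refine l3.congr fun n => ?_
    have h1 := hRx _ (hp n) x y hxy
    have h2 := hRx _ (hq n) x y hxy
    rw [map_add, map_smul] at h1 h2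
    rw [← eq_sub_iff_add_eq] at h1 h2
    rw [h1, h2]
    simp only [smul_apply, add_apply]
    set u := R _ (hp n) x
    set v := R _ (hq n) x
    push_cast
    simp only [smul_sub, smul_add, smul_smul]
    have hi : Complex.I * Complex.I = -1 := Complex.I_mul_I
    match_scalars <;> first | ring1 | linear_combination (-(((n : ℂ) + 1) ^ 2 / 2)) * hi
end SelfAdjointGraph

/-! ### Exponentials of bounded symmetric operators -/

section BoundedExponential

variable {X : Type*} [NormedAddCommGroup X] [InnerProductSpace ℂ X] [CompleteSpace X]

/-- The group `e^{-ita}` of a bounded operator. -/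
noncomputable def expGroup (a : X →L[ℂ] X) (t : ℝ) : X →L[ℂ] X :=
  NormedSpace.exp ((t : ℂ) • (-Complex.I • a))

theorem expGroup_zero (a : X →L[ℂ] X) : expGroup a 0 = 1 := by
  simp [expGroup, NormedSpace.exp_zero]

theorem expGroup_add (a : X →L[ℂ] X) (s t : ℝ) :
    expGroup a (s + t) = expGroup a s * expGroup a t := by
  let _ : NormedAlgebra ℚ (X →L[ℂ] X) := NormedAlgebra.restrictScalars ℚ ℂ _
  rw [expGroup, Complex.ofReal_add, add_smul, NormedSpace.exp_add_of_commute]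
  · rfl
  · exact ((Commute.refl _).smul_left _).smul_right _

theorem commute_expGroup {a b : X →L[ℂ] X} (h : Commute a b) (t : ℝ) :
    Commute a (expGroup b t) :=
  ((h.smul_right _).smul_right _).exp_right

theorem hasDerivAt_expGroup (a : X →L[ℂ] X) (x : X) (t : ℝ) :
    HasDerivAt (fun s => expGroup a s x) (-Complex.I • a (expGroup a t x)) t := by
  have h1 := hasDerivAt_exp_smul_const (𝕂 := ℂ) (-Complex.I • a) (t : ℂ)
  have h2 : HasDerivAt (expGroup a) (expGroup a t * (-Complex.I • a)) t := by
    have h := h1.scomp t (Complex.ofRealCLM.hasDerivAt (x := t))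
    rw [Complex.ofRealCLM_apply, Complex.ofReal_one, one_smul] at h
    exact h
  have h3 := ((ContinuousLinearMap.apply ℂ X x).restrictScalars ℝ).hasFDerivAt.comp_hasDerivAt t h2
  refine HasDerivAt.congr_deriv h3 ?_
  have hc : Commute a (expGroup a t) := commute_expGroup (Commute.refl a) t
  have h4 : a (expGroup a t x) = expGroup a t (a x) := congrArg (· x) hc.eq
  change expGroup a t ((-Complex.I • a) x) = _
  rw [smul_apply, map_smul, h4]

theorem norm_expGroup_apply {a : X →L[ℂ] X} (ha : ∀ x y, inner ℂ (a x) y = inner ℂ x (a y))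
    (t : ℝ) (x : X) : ‖expGroup a t x‖ = ‖x‖ := by
  have key : ∀ t x, ‖expGroup a t x‖ ≤ ‖x‖ := fun t x => by
    have h := norm_le_add_of_abs_re_inner_le (K := 0) le_rfl (hasDerivAt_expGroup a x)
      (fun s => by
        have him : (inner ℂ (expGroup a s x) (a (expGroup a s x))).im = 0 := by
          have h1 := ha (expGroup a s x) (expGroup a s x)
          rw [← inner_conj_symm] at h1
          exact Complex.conj_eq_iff_im.1 h1
        simp [inner_smul_right, him]) t
    simpa [expGroup_zero] using h
  refine (key t x).antisymm ?_
  have h := key (-t) (expGroup a t x)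
  have e : expGroup a (-t) (expGroup a t x) = x := by
    change (expGroup a (-t) * expGroup a t) x = x
    rw [← expGroup_add, neg_add_cancel, expGroup_zero]; rfl
  rwa [e] at h

/-- The difference `w` solves `w' = -iaw - ie^{-itb}(a - b)x`. Commutation moves `a - b` onto the
fixed vector `x`, so strong convergence of generators suffices for the groups to be Cauchy. -/
theorem norm_expGroup_sub_le {a b : X →L[ℂ] X} (ha : ∀ x y, inner ℂ (a x) y = inner ℂ x (a y))
    (hb : ∀ x y, inner ℂ (b x) y = inner ℂ x (b y)) (hab : Commute a b) (t : ℝ) (x : X) :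
    ‖expGroup a t x - expGroup b t x‖ ≤ ‖a x - b x‖ * |t| := by
  have hd : ∀ s, HasDerivAt (fun s => expGroup a s x - expGroup b s x)
      (-Complex.I • a (expGroup a s x - expGroup b s x) +
        -Complex.I • expGroup b s (a x - b x)) s := fun s => by
    refine HasDerivAt.congr_deriv ((hasDerivAt_expGroup a x s).sub (hasDerivAt_expGroup b x s)) ?_
    have h1 : a (expGroup b s x) = expGroup b s (a x) :=
      congrArg (· x) (commute_expGroup hab s).eq
    have h2 : b (expGroup b s x) = expGroup b s (b x) :=
      congrArg (· x) (commute_expGroup (Commute.refl b) s).eq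
    rw [map_sub, map_sub, h1, h2]
    module
  have h := norm_le_add_of_abs_re_inner_le (norm_nonneg (a x - b x)) hd (fun s => by
    set w := expGroup a s x - expGroup b s x
    have him : (inner ℂ w (a w)).im = 0 := by
      have h1 := ha w w
      rw [← inner_conj_symm] at h1
      exact Complex.conj_eq_iff_im.1 h1
    have h0 : (inner ℂ w (-Complex.I • a w)).re = 0 := by simp [inner_smul_right, him]
    rw [inner_add_right, Complex.add_re, h0, zero_add]
    refine (Complex.abs_re_le_norm _).trans ((norm_inner_le_norm _ _).trans ?_)
    rw [norm_smul, norm_neg, Complex.norm_I, one_mul, norm_expGroup_apply hb, mul_comm]) t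
  simpa [expGroup_zero] using h

end BoundedExponential

/-! ### Stone's theorem -/

section Stone

variable {X : Type*} [NormedAddCommGroup X] [InnerProductSpace ℂ X] [CompleteSpace X]
  {A : X →ₗ.[ℂ] X}

theorem dense_domain_of_isSelfAdjointGraph (hA : IsSelfAdjointGraph A.graph) :
    Dense {x | ∃ y, (x, y) ∈ A.graph} :=
  hA.dense_fst fun _ h => A.graph_fst_eq_zero_snd h rfl

/-- The difference of two orbits stays in the domain and has zero radial velocity, so it remains
zero. -/
theorem IsUnitaryGroup.unique (hA : IsSelfAdjointGraph A.graph) {G G' : ℝ → X →L[ℂ] X}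
    (hG : IsUnitaryGroup A G) (hG' : IsUnitaryGroup A G') : G = G' := by
  funext t
  refine ContinuousLinearMap.coeFn_injective ((G t).continuous.ext_on
    (dense_domain_of_isSelfAdjointGraph hA) (G' t).continuous ?_)
  rintro x ⟨y, h⟩
  have hd := fun s => (hG.hasDerivAt h s).sub (hG'.hasDerivAt h s)
  simp only [← smul_sub] at hd
  have h1 := norm_le_add_of_abs_re_inner_le le_rfl hd (fun s => by
    have hm := A.graph.sub_mem (hG.apply_mem_graph h s) (hG'.apply_mem_graph h s)
    have h2 := hA.re_inner_neg_I_smul hm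
    simp only [Pi.sub_apply]
    rw [h2]
    simp) t
  simpa [hG.zero, hG'.zero, sub_eq_zero] using h1

/-- **Stone's theorem**, existence half: a self-adjoint operator generates a unitary group. -/
theorem exists_isUnitaryGroup (hA : IsSelfAdjointGraph A.graph) :
    ∃ G : ℝ → X →L[ℂ] X, IsUnitaryGroup A G := by
  have hdense := dense_domain_of_isSelfAdjointGraph hA
  obtain ⟨a, ha, hcomm, hlim⟩ := hA.exists_approx fun _ h => A.graph_fst_eq_zero_snd h rfl
  set E := fun n => expGroup (a n) with hE
  have hEn : ∀ n t x, ‖E n t x‖ = ‖x‖ := fun n t x => norm_expGroup_apply (ha n) t x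
  have hcauchy : ∀ x R, UniformCauchySeqOn (fun n t => E n t x) atTop (Set.Icc (-R) R) := by
    intro x R
    rw [Metric.uniformCauchySeqOn_iff]
    intro ε hε
    obtain ⟨x', ⟨y, hxy⟩, hx⟩ := hdense.exists_dist_lt x (by positivity : 0 < ε / 4)
    obtain ⟨N, hN⟩ := Metric.cauchySeq_iff.1 (hlim x' y hxy).cauchySeq (ε / (4 * (|R| + 1)))
      (by positivity)
    refine ⟨N, fun m hm n hn t ht => ?_⟩
    have h1 := norm_expGroup_sub_le (ha m) (ha n) (hcomm m n) t x'
    have h2 := hN m hm n hn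
    rw [dist_eq_norm] at h2
    have h3 : |t| ≤ |R| + 1 := by
      have := abs_le.2 ht
      linarith [le_abs_self R]
    have h4 : ‖a m x' - a n x'‖ * |t| ≤ ε / (4 * (|R| + 1)) * (|R| + 1) := by gcongr
    have h5 : ε / (4 * (|R| + 1)) * (|R| + 1) = ε / 4 := by
      field_simp
    rw [dist_eq_norm] at hx ⊢
    have e : E m t x - E n t x =
        E m t (x - x') + (E m t x' - E n t x') - E n t (x - x') := by
      simp only [map_sub]; abel
    rw [e]
    calc _ ≤ ‖E m t (x - x')‖ + ‖E m t x' - E n t x'‖ + ‖E n t (x - x')‖ :=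
          (norm_sub_le _ _).trans (by gcongr; exact norm_add_le _ _)
      _ < ε := by rw [hEn, hEn]; linarith
  have hex : ∀ t x, ∃ z, Tendsto (fun n => E n t x) atTop (𝓝 z) := fun t x =>
    cauchySeq_tendsto_of_complete
      ((hcauchy x |t|).cauchySeq (abs_le.1 le_rfl))
  choose T hT using hex
  have hTn : ∀ t x, ‖T t x‖ = ‖x‖ := fun t x =>
    tendsto_nhds_unique (hT t x).norm (by simp [hEn])
  let G : ℝ → X →L[ℂ] X := fun t => continuousLinearMapOfTendsto (fun n => E n t)
    (f := T t) (tendsto_pi_nhds.2 (hT t))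
  have hGT : ∀ t x, G t x = T t x := fun t x => rfl
  have hloc : ∀ x, TendstoLocallyUniformly (fun n t => E n t x) (fun t => G t x) atTop := by
    intro x
    rw [tendstoLocallyUniformly_iff_forall_isCompact]
    intro K hK
    obtain ⟨R, hR⟩ := hK.isBounded.subset_closedBall 0
    rw [Real.closedBall_eq_Icc, zero_sub, zero_add] at hR
    exact ((hcauchy x R).tendstoUniformlyOn_of_tendsto fun t _ => hT t x).mono hR
  have hzero : G 0 = 1 := by
    ext x
    refine tendsto_nhds_unique (hT 0 x) ?_
    simp [hE, expGroup_zero]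
  have hEle : ∀ n t, ‖E n t‖ ≤ 1 := fun n t =>
    (E n t).opNorm_le_bound zero_le_one fun x => by rw [hEn, one_mul]
  have hadd : ∀ s t, G (s + t) = G s * G t := by
    intro s t
    ext x
    refine tendsto_nhds_unique (hT (s + t) x) ?_
    have h1 := tendsto_apply_of_norm_le (L := fun n => E n s) (L₀ := G s) (a₀ := G t x)
      (fun n => hEle n s) (hT s _) (hT t x)
    refine h1.congr fun n => ?_
    simp [hE, expGroup_add]
  have hcont : ∀ x, Continuous fun t => G t x := fun x =>
    (hloc x).continuous (Frequently.of_forall fun n =>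
      continuous_iff_continuousAt.2 fun t => (hasDerivAt_expGroup (a n) x t).continuousAt)
  have hmul : ∀ t, G (-t) * G t = 1 := fun t => by rw [← hadd, neg_add_cancel, hzero]
  have hmul' : ∀ t, G t * G (-t) = 1 := fun t => by rw [← hadd, add_neg_cancel, hzero]
  have hstar : ∀ t, star (G t) = G (-t) := fun t => by
    have h1 : star (G t) * G t = 1 := by
      rw [ContinuousLinearMap.star_eq_adjoint]
      exact (ContinuousLinearMap.norm_map_iff_adjoint_comp_self (G t)).1 fun x => hTn t x
    calc star (G t) = star (G t) * (G t * G (-t)) := by rw [hmul', mul_one]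
      _ = G (-t) := by rw [← mul_assoc, h1, one_mul]
  -- The derivatives `-iE_n(s)a_n x` converge locally uniformly to `-iG(s)y`, so the limit may be
  -- differentiated.
  have hderiv : ∀ x y, (x, y) ∈ A.graph → ∀ t, HasDerivAt (fun s => G s x) (-Complex.I • G t y) t := by
    intro x y hxy t
    refine hasDerivAt_of_tendstoLocallyUniformlyOn (l := atTop) (f := fun n s => E n s x)
      (g := fun s => G s x) (g' := fun s => -Complex.I • G s y)
      (f' := fun n s => -Complex.I • E n s (a n x)) isOpen_univ ?_ ?_ (fun s _ => hT s x)
      (Set.mem_univ t)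
    · rw [tendstoLocallyUniformlyOn_univ, Metric.tendstoLocallyUniformly_iff]
      intro ε hε s
      obtain ⟨U, hU, h⟩ := Metric.tendstoLocallyUniformly_iff.1 (hloc y) (ε / 2) (by positivity) s
      refine ⟨U, hU, ?_⟩
      filter_upwards [h, Metric.tendsto_nhds.1 (hlim x y hxy) (ε / 2) (by positivity)]
        with n h1 h2 r hr
      have h3 := h1 r hr
      rw [dist_eq_norm] at h2 h3 ⊢
      have e : -Complex.I • G r y - -Complex.I • E n r (a n x) =
          -Complex.I • ((G r y - E n r y) - E n r (a n x - y)) := by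
        rw [map_sub]; module
      rw [e, norm_smul, norm_neg, Complex.norm_I, one_mul]
      refine (norm_sub_le _ _).trans_lt ?_
      rw [hEn]
      linarith
    · refine Eventually.of_forall fun n s _ => ?_
      convert hasDerivAt_expGroup (a n) x s using 2
      exact (congrArg (· x) (commute_expGroup (Commute.refl (a n)) s).eq).symm
  refine ⟨G, hzero, hadd, fun t => Unitary.mem_iff.2 ⟨?_, ?_⟩, hcont, fun x y => ⟨fun h => ?_, fun h => ?_⟩⟩
  · rw [hstar, hmul]
  · rw [hstar, hmul']
  · simpa [hzero] using hderiv x y h 0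
  -- The generator is no larger than `-iA`: differentiating `⟨G(-t)u, x⟩ = ⟨u, G(t)x⟩` at `0` for
  -- `u` in the domain gives the adjoint condition on `(x, y)`.
  · refine (hA x y).2 fun u v huv => ?_
    have h1 : HasDerivAt (fun t => inner ℂ u (G t x)) (inner ℂ u (-Complex.I • y)) 0 :=
      ((innerSL ℂ u).restrictScalars ℝ).hasFDerivAt.comp_hasDerivAt 0 h
    have h2 : HasDerivAt (fun t => G (-t) u) (Complex.I • v) 0 := by
      have := (hderiv u v huv (-0)).scomp (0 : ℝ) (hasDerivAt_neg (0 : ℝ))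
      simpa [hzero, Function.comp_def] using this
    have h3 : HasDerivAt (fun t => inner ℂ (G (-t) u) x) (inner ℂ (Complex.I • v) x) 0 := by
      have := h2.inner ℂ (hasDerivAt_const (0 : ℝ) x)
      rwa [inner_zero_right, zero_add] at this
    have e : (fun t => inner ℂ (G (-t) u) x) = fun t => inner ℂ u (G t x) := by
      funext t
      rw [← hstar, ContinuousLinearMap.star_eq_adjoint, ContinuousLinearMap.adjoint_inner_left]
    rw [e] at h3
    have h4 := h3.unique h1
    rw [inner_smul_left, inner_smul_right, Complex.conj_I] at h4
    exact mul_left_cancel₀ (neg_ne_zero.2 Complex.I_ne_zero) h4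

end Stone

/-! ### Iterated-integral bounds -/

section Growth

variable {F : Type*} [NormedAddCommGroup F] [NormedSpace ℝ F]

theorem hasDerivAt_mul_pow_div_factorial (K M : ℝ) (k : ℕ) (t : ℝ) :
    HasDerivAt (fun s => K * ((M * s) ^ (k + 1) / (k + 1).factorial))
      (K * (M * ((M * t) ^ k / k.factorial))) t := by
  have h1 : HasDerivAt (fun s : ℝ => M * s) M t := by
    simpa using (hasDerivAt_id t).const_mul M
  refine HasDerivAt.congr_deriv (((h1.pow (k + 1)).div_const _).const_mul K) ?_
  have : (k.factorial : ℝ) ≠ 0 := by positivity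
  rw [Nat.factorial_succ]
  push_cast
  field_simp

/-- One integration raises the power and the factorial together. The same step serves the Dyson
series, each hop between modes, and the final Duhamel integral. -/
theorem norm_le_pow_div_factorial {f f' : ℝ → F} {K M : ℝ} {k : ℕ} (h0 : f 0 = 0) {T : ℝ}
    (hf : ∀ t, 0 ≤ t → t ≤ T → HasDerivAt f (f' t) t)
    (hb : ∀ t, 0 ≤ t → t ≤ T → ‖f' t‖ ≤ K * (M * ((M * t) ^ k / k.factorial))) (hT : 0 ≤ T) :
    ‖f T‖ ≤ K * ((M * T) ^ (k + 1) / (k + 1).factorial) := by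
  refine image_norm_le_of_norm_deriv_right_le_deriv_boundary (a := 0) (b := T)
    (fun t ht => (hf t ht.1 ht.2).continuousAt.continuousWithinAt)
    (fun t ht => (hf t ht.1 ht.2.le).hasDerivWithinAt) ?_
    (fun t => hasDerivAt_mul_pow_div_factorial K M k t) (fun t ht => hb t ht.1 ht.2.le)
    (Set.right_mem_Icc.2 hT)
  simp [h0]

theorem norm_le_abs_pow_div_factorial {f f' : ℝ → F} {K M : ℝ} {k : ℕ} (h0 : f 0 = 0)
    (hf : ∀ t, HasDerivAt f (f' t) t)
    (hb : ∀ t, ‖f' t‖ ≤ K * (M * ((M * |t|) ^ k / k.factorial))) (t : ℝ) :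
    ‖f t‖ ≤ K * ((M * |t|) ^ (k + 1) / (k + 1).factorial) := by
  rcases le_total 0 t with h | h
  · rw [abs_of_nonneg h]
    exact norm_le_pow_div_factorial h0 (fun s _ _ => hf s)
      (fun s hs _ => by simpa [abs_of_nonneg hs] using hb s) h
  · rw [abs_of_nonpos h]
    have h1 := norm_le_pow_div_factorial (f := fun s => f (-s)) (f' := fun s => -f' (-s)) (K := K)
      (M := M) (k := k) (T := -t) (by simp [h0])
      (fun s _ _ => by
        have := (hf (-s)).scomp s (hasDerivAt_neg s)
        rwa [neg_one_smul] at this)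
      (fun s hs _ => by simpa [abs_of_nonneg hs] using hb (-s)) (by linarith)
    simpa using h1

end Growth

/-! ### Dyson series for a bounded, strongly continuous generator -/

section LinearODE

variable {X : Type*} [NormedAddCommGroup X] [InnerProductSpace ℂ X]

theorem re_inner_neg_I_smul_apply {a : X →L[ℂ] X}
    (ha : ∀ x y, inner ℂ (a x) y = inner ℂ x (a y)) (x : X) :
    (inner ℂ x (-Complex.I • a x)).re = 0 := by
  have h1 := ha x x
  rw [← inner_conj_symm] at h1
  simp [inner_smul_right, Complex.conj_eq_iff_im.1 h1]

/-- The iterated integrals of the Dyson series of `f' = W f`, `f 0 = x`. -/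
noncomputable def dysonTerm (W : ℝ → X →L[ℂ] X) (x : X) : ℕ → ℝ → X
  | 0 => fun _ => x
  | k + 1 => fun t => ∫ s in (0 : ℝ)..t, W s (dysonTerm W x k s)

variable {W : ℝ → X →L[ℂ] X} {M : ℝ}

theorem continuous_clm_apply_of_norm_le (hM : ∀ t, ‖W t‖ ≤ M)
    (hc : ∀ x, Continuous fun t => W t x) {f : ℝ → X} (hf : Continuous f) :
    Continuous fun t => W t (f t) :=
  continuous_iff_continuousAt.2 fun t =>
    tendsto_apply_of_norm_le (L₀ := W t) hM (hc (f t)).continuousAt hf.continuousAt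

theorem continuous_dysonTerm (hM : ∀ t, ‖W t‖ ≤ M) (hc : ∀ x, Continuous fun t => W t x) (x : X)
    (k : ℕ) : Continuous (dysonTerm W x k) := by
  induction k with
  | zero => exact continuous_const
  | succ k ih =>
    exact intervalIntegral.continuous_primitive (fun a b =>
      (continuous_clm_apply_of_norm_le hM hc ih).intervalIntegrable a b) 0

variable [CompleteSpace X]

theorem hasDerivAt_dysonTerm (hM : ∀ t, ‖W t‖ ≤ M) (hc : ∀ x, Continuous fun t => W t x) (x : X)
    (k : ℕ) (t : ℝ) : HasDerivAt (dysonTerm W x (k + 1)) (W t (dysonTerm W x k t)) t :=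
  ((continuous_clm_apply_of_norm_le hM hc
    (continuous_dysonTerm hM hc x k)).integral_hasStrictDerivAt 0 t).hasDerivAt

theorem norm_dysonTerm_le (hM : ∀ t, ‖W t‖ ≤ M) (hc : ∀ x, Continuous fun t => W t x) (x : X)
    (k : ℕ) (t : ℝ) : ‖dysonTerm W x k t‖ ≤ ‖x‖ * ((M * |t|) ^ k / k.factorial) := by
  induction k generalizing t with
  | zero => simp [dysonTerm]
  | succ k ih =>
    refine norm_le_abs_pow_div_factorial (by simp [dysonTerm]) (hasDerivAt_dysonTerm hM hc x k)
      (fun s => ?_) t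
    refine ((W s).le_of_opNorm_le (hM s) _).trans ?_
    have hM0 : 0 ≤ M := (norm_nonneg _).trans (hM 0)
    calc M * ‖dysonTerm W x k s‖ ≤ M * (‖x‖ * ((M * |s|) ^ k / k.factorial)) := by
          gcongr; exact ih s
      _ = _ := by ring

/-- Since `W` is only strongly continuous, the series is built vector by vector; domination by an
exponential series on a ball allows termwise differentiation. -/
theorem exists_solution_linear_ode (hM : ∀ t, ‖W t‖ ≤ M) (hc : ∀ x, Continuous fun t => W t x)
    (x : X) : ∃ f : ℝ → X, f 0 = x ∧ ∀ t, HasDerivAt f (W t (f t)) t := by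
  have hM0 : 0 ≤ M := (norm_nonneg _).trans (hM 0)
  have hs : ∀ t, Summable fun k => dysonTerm W x k t := fun t =>
    Summable.of_norm_bounded ((Real.summable_pow_div_factorial (M * |t|)).mul_left ‖x‖)
      fun k => norm_dysonTerm_le hM hc x k t
  refine ⟨fun t => x + ∑' k, dysonTerm W x (k + 1) t, by simp [dysonTerm], fun t => ?_⟩
  have h1 : HasDerivAt (fun t => ∑' k, dysonTerm W x (k + 1) t)
      (∑' k, W t (dysonTerm W x k t)) t := by
    refine hasDerivAt_tsum_of_isPreconnected (t := Metric.ball (0 : ℝ) (|t| + 1)) (y₀ := 0)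
      (g' := fun k t => W t (dysonTerm W x k t))
      (u := fun k => M * (‖x‖ * ((M * (|t| + 1)) ^ k / k.factorial)))
      (((Real.summable_pow_div_factorial (M * (|t| + 1))).mul_left ‖x‖).mul_left M)
      Metric.isOpen_ball (convex_ball (0 : ℝ) _).isPreconnected
      (fun k s _ => hasDerivAt_dysonTerm hM hc x k s) (fun k s hs => ?_)
      (Metric.mem_ball_self (by positivity)) ((summable_nat_add_iff 1).2 (hs 0)) (by simp)
    have hs' : |s| ≤ |t| + 1 := by
      have := Metric.mem_ball.1 hs
      rw [dist_zero_right, Real.norm_eq_abs] at this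
      exact this.le
    refine ((W s).le_of_opNorm_le (hM s) _).trans ?_
    gcongr
    refine (norm_dysonTerm_le hM hc x k s).trans ?_
    gcongr
  refine (h1.const_add x).congr_deriv ?_
  rw [← (W t).map_tsum (hs t), (hs t).tsum_eq_zero_add]
  rfl

/-- A skew-adjoint, strongly continuous, bounded family `W` has a contractive propagator. -/
theorem exists_contractive_propagator (hM : ∀ t, ‖W t‖ ≤ M) (hc : ∀ x, Continuous fun t => W t x)
    (hW : ∀ t x, (inner ℂ x (W t x)).re = 0) :
    ∃ V : ℝ → X →L[ℂ] X, V 0 = 1 ∧ (∀ t x, ‖V t x‖ ≤ ‖x‖) ∧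
      ∀ x t, HasDerivAt (fun s => V s x) (W t (V t x)) t := by
  choose f hf0 hf using exists_solution_linear_ode hM hc
  have hnorm : ∀ g : ℝ → X, (∀ t, HasDerivAt g (W t (g t)) t) → ∀ t, ‖g t‖ ≤ ‖g 0‖ :=
    fun g hg t => by
      simpa using norm_le_add_of_abs_re_inner_le le_rfl hg (fun s => by simp [hW]) t
  -- Linearity is uniqueness: the defect of additivity or homogeneity solves the equation with zero
  -- initial value.
  let V : ℝ → X →ₗ[ℂ] X := fun t =>
    { toFun := fun x => f x t
      map_add' := fun x y => by
        have := hnorm (fun s => f (x + y) s - (f x s + f y s)) (fun s => by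
          simp only [map_sub, map_add]
          exact (hf _ s).sub ((hf x s).add (hf y s))) t
        simpa [hf0, sub_eq_zero] using this
      map_smul' := fun c x => by
        have := hnorm (fun s => f (c • x) s - c • f x s) (fun s => by
          simp only [map_sub, map_smul]
          exact (hf _ s).sub ((hf x s).const_smul c)) t
        simpa [hf0, sub_eq_zero] using this }
  refine ⟨fun t => (V t).mkContinuous 1 fun x => ?_, ?_, fun t x => ?_, fun x t => hf x t⟩
  · rw [one_mul, ← congrArg norm (hf0 x)]
    exact hnorm (f x) (hf x) t
  · ext x
    exact hf0 x
  · rw [← congrArg norm (hf0 x)]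
    exact hnorm (f x) (hf x) t

end LinearODE

/-! ### Propagators for a bounded time-dependent perturbation -/

section Evolution

variable {X : Type*} [NormedAddCommGroup X] [InnerProductSpace ℂ X] [CompleteSpace X]
  {A : X →ₗ.[ℂ] X} {G : ℝ → X →L[ℂ] X}

/-- A vector along which a unitary group is Lipschitz at time `0` is in the domain of the
generator. -/
theorem IsUnitaryGroup.exists_mem_graph_of_norm_sub_le (hG : IsUnitaryGroup A G)
    (hA : IsSelfAdjointGraph A.graph) {x : X} {K : ℝ} (hK : 0 ≤ K)
    (h : ∀ t, ‖G t x - x‖ ≤ K * |t|) : ∃ y, (x, y) ∈ A.graph := by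
  -- Moving the group onto `x` bounds the derivative of `⟨x, G(t)u⟩`. Thus `u ↦ ⟨x, Au⟩` is bounded,
  -- and the Riesz vector of an extension is the required `y`.
  have hbound : ∀ u : A.domain, ‖inner ℂ x (A u)‖ ≤ K * ‖u‖ := fun u => by
    have h0 := hG.hasDerivAt (A.mem_graph u) 0
    rw [hG.zero] at h0
    have h1 : HasDerivAt (fun t => inner ℂ x (G t u)) (inner ℂ x (-Complex.I • A u)) 0 :=
      ((innerSL ℂ x).restrictScalars ℝ).hasFDerivAt.comp_hasDerivAt 0 h0
    have h2 := h1.le_of_lip' (C := K * ‖u‖) (by positivity) (Eventually.of_forall fun t => by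
      have e : inner ℂ x (G t u) - inner ℂ x (G 0 u) = inner ℂ (G (-t) x - x) (u : X) := by
        rw [inner_sub_left, hG.inner_apply_left, neg_neg, hG.zero]; rfl
      rw [e, sub_zero, Real.norm_eq_abs]
      refine (norm_inner_le_norm _ _).trans ?_
      have := h (-t)
      rw [abs_neg] at this
      calc _ ≤ K * |t| * ‖(u : X)‖ := by gcongr
        _ = _ := by rw [Submodule.coe_norm]; ring)
    simpa [inner_smul_right] using h2
  let l : A.domain →ₗ[ℂ] ℂ := (innerSL ℂ x).toLinearMap ∘ₗ A.toFun
  obtain ⟨g, hg, -⟩ := exists_extension_norm_eq A.domain (l.mkContinuous K hbound)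
  refine ⟨(InnerProductSpace.toDual ℂ X).symm g, (hA _ _).2 fun u v huv => ?_⟩
  obtain ⟨u', rfl, rfl⟩ := (A.mem_graph_iff).1 huv
  have h1 : inner ℂ ((InnerProductSpace.toDual ℂ X).symm g) (u' : X) = inner ℂ x (A u') := by
    rw [InnerProductSpace.toDual_symm_apply, hg]; rfl
  rw [← inner_conj_symm, ← h1, inner_conj_symm]

/-- `U` propagates `i u' = (A + C(t)) u` on the domain of `A`. -/
def IsPropagator (A : X →ₗ.[ℂ] X) (C U : ℝ → X →L[ℂ] X) : Prop :=
  U 0 = 1 ∧ ∀ x y, (x, y) ∈ A.graph → ∀ t, ∃ z, (U t x, z) ∈ A.graph ∧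
    HasDerivAt (fun s => U s x) (-Complex.I • (z + C t (U t x))) t

variable {C : ℝ → X →L[ℂ] X}

theorem IsPropagator.unique {U U' : ℝ → X →L[ℂ] X} (hU : IsPropagator A C U)
    (hU' : IsPropagator A C U') (hA : IsSelfAdjointGraph A.graph)
    (hC : ∀ t x y, inner ℂ (C t x) y = inner ℂ x (C t y)) : U = U' := by
  funext t
  refine ContinuousLinearMap.coeFn_injective ((U t).continuous.ext_on
    (dense_domain_of_isSelfAdjointGraph hA) (U' t).continuous ?_)
  rintro x ⟨y, h⟩
  choose z hz hd using hU.2 x y h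
  choose z' hz' hd' using hU'.2 x y h
  have h1 := norm_le_add_of_abs_re_inner_le le_rfl (fun s => (hd s).sub (hd' s)) (fun s => by
    have hm := hA.re_inner_neg_I_smul (A.graph.sub_mem (hz s) (hz' s))
    have hm' := re_inner_neg_I_smul_apply (hC s) (U s x - U' s x)
    have e : -Complex.I • (z s + C s (U s x)) - -Complex.I • (z' s + C s (U' s x)) =
        -Complex.I • (z s - z' s) + -Complex.I • C s (U s x - U' s x) := by
      rw [map_sub]; module
    simp only [Pi.sub_apply]
    rw [e, inner_add_right, Complex.add_re, hm', add_zero]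
    exact (congrArg abs hm).trans_le (by simp)) t
  simpa [hU.1, hU'.1, sub_eq_zero] using h1

theorem IsPropagator.norm_apply_le {U : ℝ → X →L[ℂ] X} (hU : IsPropagator A C U)
    (hA : IsSelfAdjointGraph A.graph) (hC : ∀ t x y, inner ℂ (C t x) y = inner ℂ x (C t y))
    (t : ℝ) (x : X) : ‖U t x‖ ≤ ‖x‖ := by
  refine (dense_domain_of_isSelfAdjointGraph hA).induction (P := fun x => ‖U t x‖ ≤ ‖x‖) ?_
    (isClosed_le (by fun_prop) (by fun_prop)) x
  rintro x ⟨y, h⟩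
  choose z hz hd using hU.2 x y h
  have h1 := norm_le_add_of_abs_re_inner_le le_rfl hd (fun s => by
    rw [smul_add, inner_add_right, Complex.add_re, re_inner_neg_I_smul_apply (hC s) (U s x),
      hA.re_inner_neg_I_smul (hz s)]
    simp) t
  simpa [hU.1] using h1

/-- Interaction picture: `U = GV`, where `V` solves the bounded skew equation with `W =
-iG(-t)C(t)G(t)`. The substance is invariance of the domain: the time-shifted curve `G(h)V(t+h)x`
solves the same equation up to the source `C(t+h) - C(t) = O(h)`, so it stays `O(h)`-close to
`V(t)x`. -/
theorem exists_isPropagator (hA : IsSelfAdjointGraph A.graph)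
    (hC : ∀ t x y, inner ℂ (C t x) y = inner ℂ x (C t y)) {M L : ℝ} (hM : ∀ t, ‖C t‖ ≤ M)
    (hL : ∀ s t, ‖C s - C t‖ ≤ L * |s - t|) : ∃ U, IsPropagator A C U := by
  obtain ⟨G, hG⟩ := exists_isUnitaryGroup hA
  have hM0 : 0 ≤ M := (norm_nonneg _).trans (hM 0)
  have hL0 : 0 ≤ L := by
    have := (norm_nonneg _).trans (hL 1 0)
    simpa using this
  have hCc : Continuous C := by
    refine (LipschitzWith.of_dist_le_mul (K := ⟨L, hL0⟩) fun s t => ?_).continuous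
    rw [dist_eq_norm]
    exact hL s t
  let W : ℝ → X →L[ℂ] X := fun t => -Complex.I • (G (-t) ∘L C t ∘L G t)
  have hWa : ∀ t x, W t x = -Complex.I • G (-t) (C t (G t x)) := fun t x => rfl
  have hCG : ∀ t x, ‖C t (G t x)‖ ≤ M * ‖x‖ := fun t x => by
    simpa [hG.norm_apply] using (C t).le_of_opNorm_le (hM t) (G t x)
  have hWx : ∀ t x, ‖W t x‖ ≤ M * ‖x‖ := fun t x => by
    rw [hWa, norm_smul, norm_neg, Complex.norm_I, one_mul, hG.norm_apply]
    exact hCG t x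
  have hWM : ∀ t, ‖W t‖ ≤ M := fun t => (W t).opNorm_le_bound hM0 (hWx t)
  have hWc : ∀ x, Continuous fun t => W t x := fun x => by
    refine continuous_const.smul ?_
    refine continuous_clm_apply_of_norm_le (W := fun t => G (-t)) (fun t => hG.norm_le _)
      (fun y => (hG.continuous y).comp continuous_neg) ?_
    exact hCc.clm_apply (hG.continuous x)
  have hWre : ∀ t x, (inner ℂ x (W t x)).re = 0 := fun t x => by
    refine re_inner_neg_I_smul_apply (a := G (-t) ∘L C t ∘L G t) (fun u v => ?_) x
    simp only [ContinuousLinearMap.comp_apply]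
    rw [hG.inner_apply_left, neg_neg, hC, hG.inner_apply_left]
  obtain ⟨V, hV0, hVn, hVd⟩ := exists_contractive_propagator hWM hWc hWre
  have hVlip : ∀ x s t, ‖V t x - V s x‖ ≤ M * ‖x‖ * |t - s| := fun x s t =>
    convex_univ.norm_image_sub_le_of_norm_hasDerivWithin_le
      (fun s _ => (hVd x s).hasDerivWithinAt)
      (fun s _ => (hWx s _).trans (by gcongr; exact hVn s x)) (Set.mem_univ s) (Set.mem_univ t)
  refine ⟨fun t => G t ∘L V t, by simp only [hG.zero, hV0]; rfl, fun x y hxy t => ?_⟩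
  -- the solution is Lipschitz in time
  have hshift : ∀ h, ‖G h (V (t + h) x) - V t x‖ ≤
      (M * ‖x‖ + ‖y‖ + L * ‖x‖ * |t|) * |h| := fun h => by
    have hd : ∀ s, HasDerivAt (fun s => G h (V (s + h) x) - V s x)
        (W s (G h (V (s + h) x) - V s x) +
          -Complex.I • G (-s) ((C (s + h) - C s) (G (s + h) (V (s + h) x)))) s := fun s => by
      have h1 : HasDerivAt (fun s => V (s + h) x) (W (s + h) (V (s + h) x)) s :=
        (hVd x (s + h)).comp_add_const s h
      have h2 := ((G h).restrictScalars ℝ).hasFDerivAt.comp_hasDerivAt s h1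
      refine HasDerivAt.congr_deriv (h2.sub (hVd x s)) ?_
      simp only [ContinuousLinearMap.coe_restrictScalars', map_sub, sub_apply, hWa, map_smul,
        hG.apply_apply]
      rw [show h + -(s + h) = -s by ring]
      module
    have h1 := norm_le_add_of_abs_re_inner_le (K := L * ‖x‖ * |h|) (by positivity) hd (fun s => by
      rw [inner_add_right, Complex.add_re, hWre, zero_add]
      refine (Complex.abs_re_le_norm _).trans ((norm_inner_le_norm _ _).trans ?_)
      rw [norm_smul, norm_neg, Complex.norm_I, one_mul, hG.norm_apply, mul_comm]
      gcongr
      refine ((C (s + h) - C s).le_of_opNorm_le (hL (s + h) s) _).trans ?_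
      rw [hG.norm_apply, add_sub_cancel_left, mul_right_comm]
      gcongr
      exact hVn _ x) t
    have h2 : ‖G h (V (0 + h) x) - V 0 x‖ ≤ (M * ‖x‖ + ‖y‖) * |h| := by
      have e : G h (V (0 + h) x) - V 0 x = G h (V h x - V 0 x) + (G h x - x) := by
        rw [map_sub, zero_add, hV0]
        simp
      rw [e, add_mul]
      refine (norm_add_le _ _).trans (add_le_add ?_ (norm_sub_le_of_mem_graph hG hxy h))
      rw [hG.norm_apply]
      simpa using hVlip x 0 h
    calc _ ≤ _ := h1
      _ ≤ (M * ‖x‖ + ‖y‖) * |h| + L * ‖x‖ * |h| * |t| := by gcongr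
      _ = _ := by ring
  -- The constant adds the Lipschitz constant of `V` to the one from `hshift`; together they make
  -- the group Lipschitz at `0` along `U(t)x`.
  obtain ⟨z, hz⟩ := hG.exists_mem_graph_of_norm_sub_le hA (x := G t (V t x))
    (K := M * ‖x‖ + (M * ‖x‖ + ‖y‖ + L * ‖x‖ * |t|)) (by positivity) (fun h => by
      have e : G h (G t (V t x)) - G t (V t x) =
          G (t + h) (V t x - V (t + h) x) + G t (G h (V (t + h) x) - V t x) := by
        simp only [map_sub, hG.apply_apply, add_comm h t]
        abel
      rw [e, add_mul]
      refine (norm_add_le _ _).trans ?_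
      rw [hG.norm_apply, hG.norm_apply]
      refine add_le_add ?_ (hshift h)
      have := hVlip x (t + h) t
      rwa [sub_add_cancel_left, abs_neg] at this)
  refine ⟨z, hz, ?_⟩
  have hz' : (V t x, G (-t) z) ∈ A.graph := by
    have := hG.apply_mem_graph hz (-t)
    rwa [hG.neg_apply_apply] at this
  have h1 := hG.hasDerivAt_apply 1 0 (hVd x t) hz'
  simp only [one_mul, add_zero, Complex.ofReal_one] at h1
  refine HasDerivAt.congr_deriv h1 ?_
  rw [hWa, map_sub, map_smul, map_smul, hG.apply_neg_apply, hG.apply_neg_apply]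
  simp only [ContinuousLinearMap.comp_apply]
  module

end Evolution

/-! ### The dense-range criterion for self-adjointness -/

section EssentialSelfAdjointness

variable {X : Type*} [NormedAddCommGroup X] [InnerProductSpace ℂ X] [CompleteSpace X]

/-- The adjoint relation of a symmetric relation with dense ranges `ran(Γ₀ ± i)` is self-adjoint. -/
theorem isSelfAdjointGraph_of_dense_range {Γ₀ Γ : Submodule ℂ (X × X)}
    (hΓ : ∀ x y, (x, y) ∈ Γ ↔ ∀ u v, (u, v) ∈ Γ₀ → inner ℂ v x = inner ℂ u y)
    (hsymm : Γ₀ ≤ Γ)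
    (hpos : ∀ z, (∀ u v, (u, v) ∈ Γ₀ → inner ℂ (v + Complex.I • u) z = 0) → z = 0)
    (hneg : ∀ z, (∀ u v, (u, v) ∈ Γ₀ → inner ℂ (v - Complex.I • u) z = 0) → z = 0) :
    IsSelfAdjointGraph Γ := by
  set E := Γ₀.topologicalClosure with hE
  have hEc : IsClosed (E : Set (X × X)) := Γ₀.isClosed_topologicalClosure
  have hext : ∀ x y, (x, y) ∈ Γ → ∀ q ∈ E, inner ℂ q.2 x = inner ℂ q.1 y := by
    intro x y h q hq
    have hcl : IsClosed {q : X × X | inner ℂ q.2 x = inner ℂ q.1 y} :=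
      isClosed_eq (by fun_prop) (by fun_prop)
    exact hcl.closure_subset_iff.2 (fun q hq => (hΓ x y).1 h q.1 q.2 hq) hq
  have hEΓ : E ≤ Γ := by
    rintro ⟨x, y⟩ hp
    refine (hΓ x y).2 fun u v huv => ?_
    have h1 := hext u v (hsymm huv) _ hp
    rw [← inner_conj_symm, ← h1, inner_conj_symm]
  have hEim : ∀ p ∈ E, (inner ℂ p.1 p.2).im = 0 := by
    rintro ⟨x, y⟩ hp
    have h1 := hext x y (hEΓ hp) _ hp
    rw [← inner_conj_symm] at h1
    exact Complex.conj_eq_iff_im.1 h1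
  -- Surjectivity of `E + i` gives `p ∈ E` with the same image as `(x, y)`. The difference lies in
  -- `Γ` with second entry `-i` times the first, so its first entry is orthogonal to `ran(Γ₀ - i)`
  -- and vanishes.
  have hΓE : Γ ≤ E := by
    rintro ⟨x, y⟩ h
    obtain ⟨p, hp, hpz⟩ := surjective_shiftMap_of_orthogonal hEc hEim one_ne_zero (fun z hz => by
      refine hpos z fun u v huv => ?_
      simpa [shiftMap_apply] using hz (u, v) (Γ₀.le_topologicalClosure huv)) (y + Complex.I • x)
    have hd : (x, y) - p ∈ Γ := Γ.sub_mem h (hEΓ hp)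
    have h2 : ((x, y) - p).2 = -Complex.I • ((x, y) - p).1 := by
      simp only [shiftMap_apply, Complex.ofReal_one, one_mul] at hpz
      simp only [Prod.snd_sub, Prod.fst_sub]
      rw [sub_eq_iff_eq_add, neg_smul, smul_sub, neg_sub, sub_add_eq_add_sub,
        add_comm (Complex.I • p.1), hpz, add_sub_cancel_right]
    have h1 : ((x, y) - p).1 = 0 := by
      refine hneg _ fun u v huv => ?_
      have := (hΓ _ _).1 hd u v huv
      rw [show ((x, y).2 - p.2) = -Complex.I • ((x, y) - p).1 from h2, inner_smul_right] at this
      change inner ℂ v ((x, y) - p).1 = _ at this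
      rw [inner_sub_left, inner_smul_left, this, Complex.conj_I]
      ring
    have h3 : (x, y) = p := by
      rw [h1, smul_zero] at h2
      exact sub_eq_zero.1 (Prod.ext h1 h2)
    rwa [h3]
  refine fun x y => ⟨fun h u v huv => hext x y h _ (hΓE huv), fun h => ?_⟩
  exact (hΓ x y).2 fun u v huv => h u v (hsymm huv)

end EssentialSelfAdjointness

/-! ### Self-adjointness of the Dirac operator -/

section Dirac

theorem toEuclideanCLM_sigma1_apply (v : Spinor) :
    Matrix.toEuclideanCLM (𝕜 := ℂ) sigma1 v = !₂[v 1, v 0] := by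
  ext i
  rw [Matrix.ofLp_toEuclideanCLM]
  fin_cases i <;> simp [sigma1, Matrix.mulVec, dotProduct]

theorem toEuclideanCLM_sigma2_apply (v : Spinor) :
    Matrix.toEuclideanCLM (𝕜 := ℂ) sigma2 v = !₂[-Complex.I * v 1, Complex.I * v 0] := by
  ext i
  rw [Matrix.ofLp_toEuclideanCLM]
  fin_cases i <;> simp [sigma2, Matrix.mulVec, dotProduct]

theorem inner_toLp_lineDerivOp (φ η : 𝓢(Plane, Spinor)) (v : Plane) :
    inner ℂ ((∂_{v} φ).toLp 2 : State) (η.toLp 2 : State) =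
      -inner ℂ (φ.toLp 2 : State) ((∂_{v} η).toLp 2 : State) := by
  rw [SchwartzMap.inner_toL2_toL2_eq _ _ volume, SchwartzMap.inner_toL2_toL2_eq _ _ volume]
  have h := SchwartzMap.integral_bilinear_lineDerivOp_right_eq_neg_left (μ := volume) φ η
    (isBoundedBilinearMap_inner (𝕜 := ℂ) (E := Spinor)).toContinuousLinearMap v
  simp only [IsBoundedBilinearMap.toContinuousLinearMap_apply] at h
  rw [h, neg_neg]

theorem inner_toLp_postcompCLM {a : Spinor →L[ℂ] Spinor}
    (ha : ∀ u v, inner ℂ (a u) v = inner ℂ u (a v)) (φ η : 𝓢(Plane, Spinor)) :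
    inner ℂ ((SchwartzMap.postcompCLM (𝕜 := ℂ) a φ).toLp 2 : State) (η.toLp 2 : State) =
      inner ℂ (φ.toLp 2 : State) ((SchwartzMap.postcompCLM (𝕜 := ℂ) a η).toLp 2 : State) := by
  rw [SchwartzMap.inner_toL2_toL2_eq _ _ volume, SchwartzMap.inner_toL2_toL2_eq _ _ volume]
  simp only [SchwartzMap.postcompCLM_apply, ha]

theorem lineDerivOp_postcompCLM (a : Spinor →L[ℂ] Spinor) (φ : 𝓢(Plane, Spinor)) (v : Plane) :
    ∂_{v} (SchwartzMap.postcompCLM (𝕜 := ℂ) a φ) = SchwartzMap.postcompCLM (𝕜 := ℂ) a (∂_{v} φ) := by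
  ext1 x
  rw [SchwartzMap.postcompCLM_apply, SchwartzMap.lineDerivOp_apply_eq_fderiv,
    SchwartzMap.lineDerivOp_apply_eq_fderiv]
  have h := (a.restrictScalars ℝ).hasFDerivAt.comp x (φ.hasFDerivAt x)
  exact congrArg (· v) h.fderiv

theorem lineDerivOp_comm (φ : 𝓢(Plane, Spinor)) (v w : Plane) :
    ∂_{v} (∂_{w} φ) = ∂_{w} (∂_{v} φ) := by
  have h : ∀ (m : Plane) (f : 𝓢(Plane, Spinor)), ∂_{m} f = (2 * Real.pi * Complex.I) •
      SchwartzMap.fourierMultiplierCLM Spinor (fun x : Plane => ((inner ℝ x m : ℝ) : ℂ)) f :=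
    fun m f => by
      rw [SchwartzMap.lineDeriv_eq_fourierMultiplierCLM]
      exact congrArg _ (SchwartzMap.fourierMultiplierCLM_ofReal ℂ (by fun_prop) f).symm
  rw [h v (∂_{w} φ), h w φ, h w (∂_{v} φ), h v φ, map_smul, map_smul,
    SchwartzMap.fourierMultiplierCLM_fourierMultiplierCLM_apply (by fun_prop) (by fun_prop),
    SchwartzMap.fourierMultiplierCLM_fourierMultiplierCLM_apply (by fun_prop) (by fun_prop),
    mul_comm (fun x : Plane => ((inner ℝ x v : ℝ) : ℂ))]

open Laplacian

/-- The Pauli matrices square to one and anticommute, while the derivatives commute, so the mixed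
terms cancel. -/
theorem diracSchwartz_diracSchwartz (φ : 𝓢(Plane, Spinor)) :
    diracSchwartz (diracSchwartz φ) = -Δ φ := by
  rw [SchwartzMap.laplacian_eq_sum (EuclideanSpace.basisFun (Fin 2) ℝ)]
  simp only [diracSchwartz, LineDeriv.lineDerivOp_add, LineDeriv.lineDerivOp_smul, lineDerivOp_postcompCLM,
    Fin.sum_univ_two, EuclideanSpace.basisFun_apply]
  rw [lineDerivOp_comm φ (EuclideanSpace.single 1 1) (EuclideanSpace.single 0 1)]
  ext x i
  simp only [smul_apply, add_apply, neg_apply, map_add, map_smul,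
    SchwartzMap.postcompCLM_apply, toEuclideanCLM_sigma1_apply, toEuclideanCLM_sigma2_apply]
  fin_cases i <;> simp <;> ring_nf <;> simp

theorem exists_sub_laplacian_eq (η : 𝓢(Plane, Spinor)) : ∃ χ : 𝓢(Plane, Spinor), χ - Δ χ = η := by
  -- With this Fourier normalisation `1 - Δ` has symbol `1 + c²‖x‖²`; its inverse `g` has temperate
  -- growth, so it acts on Schwartz space.
  let c : ℝ := 2 * Real.pi
  let g : Plane → ℝ := (fun y => (1 + ‖y‖ ^ 2) ^ (-1 : ℝ)) ∘ fun x => c • x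
  have hc : (fun x : Plane => c • x).HasTemperateGrowth :=
    (c • ContinuousLinearMap.id ℝ Plane).hasTemperateGrowth
  have hg : g.HasTemperateGrowth :=
    (Function.hasTemperateGrowth_one_add_norm_sq_rpow Plane (-1)).comp hc
  have hn : (fun x : Plane => ‖x‖ ^ 2).HasTemperateGrowth := by fun_prop
  have hgx : ∀ x, g x + c ^ 2 * (‖x‖ ^ 2 * g x) = 1 := fun x => by
    have h1 : g x = (1 + c ^ 2 * ‖x‖ ^ 2)⁻¹ := by
      simp only [g, Function.comp_apply]
      rw [norm_smul, mul_pow, Real.norm_eq_abs, sq_abs, Real.rpow_neg_one]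
    have h2 : 1 + c ^ 2 * ‖x‖ ^ 2 ≠ 0 := by positivity
    rw [h1]
    field_simp
  refine ⟨SchwartzMap.fourierMultiplierCLM Spinor g η, ?_⟩
  rw [SchwartzMap.laplacian_eq_fourierMultiplierCLM,
    SchwartzMap.fourierMultiplierCLM_fourierMultiplierCLM_apply hn hg, neg_smul, sub_neg_eq_add,
    SchwartzMap.fourierMultiplierCLM_apply, SchwartzMap.fourierMultiplierCLM_apply,
    ← FourierTransform.fourierInv_smul, ← FourierTransform.fourierInv_add]
  refine Eq.trans ?_ (FourierTransform.fourierInv_fourier_eq (F := 𝓢(Plane, Spinor)) η)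
  congr 1
  ext1 x
  rw [add_apply, smul_apply, SchwartzMap.smulLeftCLM_apply_apply hg,
    SchwartzMap.smulLeftCLM_apply_apply (hn.mul hg), smul_smul, ← add_smul]
  simp only [Pi.mul_apply]
  rw [hgx x, one_smul]

theorem diracSchwartz_add (φ η : 𝓢(Plane, Spinor)) :
    diracSchwartz (φ + η) = diracSchwartz φ + diracSchwartz η := by
  simp only [diracSchwartz, LineDeriv.lineDerivOp_add, map_add, smul_add]
  abel

theorem diracSchwartz_smul (c : ℂ) (φ : 𝓢(Plane, Spinor)) :
    diracSchwartz (c • φ) = c • diracSchwartz φ := by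
  simp only [diracSchwartz, LineDeriv.lineDerivOp_smul, map_smul, smul_add, smul_comm c]

/-- Factorisation: `(D·σ + c)(D·σ - c) = -Δ + 1`, and `1 - Δ` is onto. -/
theorem exists_diracSchwartz_add_smul_eq {c : ℂ} (hc : c * c = -1) (η : 𝓢(Plane, Spinor)) :
    ∃ φ, diracSchwartz φ + c • φ = η := by
  obtain ⟨χ, rfl⟩ := exists_sub_laplacian_eq η
  refine ⟨diracSchwartz χ + (-c) • χ, ?_⟩
  rw [diracSchwartz_add, diracSchwartz_smul, diracSchwartz_diracSchwartz, smul_add, smul_smul,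
    mul_neg, hc]
  module

theorem inner_sigma1_apply (u v : Spinor) :
    inner ℂ (Matrix.toEuclideanCLM (𝕜 := ℂ) sigma1 u) v =
      inner ℂ u (Matrix.toEuclideanCLM (𝕜 := ℂ) sigma1 v) := by
  rw [toEuclideanCLM_sigma1_apply, toEuclideanCLM_sigma1_apply]
  simp [PiLp.inner_apply, Fin.sum_univ_two]
  ring

theorem inner_sigma2_apply (u v : Spinor) :
    inner ℂ (Matrix.toEuclideanCLM (𝕜 := ℂ) sigma2 u) v =
      inner ℂ u (Matrix.toEuclideanCLM (𝕜 := ℂ) sigma2 v) := by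
  rw [toEuclideanCLM_sigma2_apply, toEuclideanCLM_sigma2_apply]
  simp [PiLp.inner_apply, Fin.sum_univ_two]
  ring

theorem schwartz_toLp_add (φ η : 𝓢(Plane, Spinor)) :
    ((φ + η).toLp 2 : State) = (φ.toLp 2 : State) + (η.toLp 2 : State) :=
  map_add (SchwartzMap.toLpCLM ℂ Spinor 2 (volume : Measure Plane)) φ η

theorem schwartz_toLp_smul (c : ℂ) (φ : 𝓢(Plane, Spinor)) :
    ((c • φ).toLp 2 : State) = c • (φ.toLp 2 : State) :=
  map_smul (SchwartzMap.toLpCLM ℂ Spinor 2 (volume : Measure Plane)) c φ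

theorem inner_toLp_diracSchwartz (φ η : 𝓢(Plane, Spinor)) :
    inner ℂ ((diracSchwartz φ).toLp 2 : State) (η.toLp 2 : State) =
      inner ℂ (φ.toLp 2 : State) ((diracSchwartz η).toLp 2 : State) := by
  simp only [diracSchwartz, schwartz_toLp_add, schwartz_toLp_smul, inner_smul_left,
    inner_smul_right, inner_add_left, inner_add_right]
  rw [inner_toLp_postcompCLM inner_sigma1_apply, inner_toLp_postcompCLM inner_sigma2_apply,
    inner_toLp_lineDerivOp, inner_toLp_lineDerivOp, lineDerivOp_postcompCLM,
    lineDerivOp_postcompCLM]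
  simp only [map_neg, Complex.conj_I]
  ring

/-- The graph of the Dirac operator on Schwartz functions. -/
noncomputable def diracSchwartzGraph : Submodule ℂ (State × State) where
  carrier := {p | ∃ φ : 𝓢(Plane, Spinor), p = (φ.toLp 2, (diracSchwartz φ).toLp 2)}
  add_mem' := by
    rintro _ _ ⟨φ, rfl⟩ ⟨η, rfl⟩
    exact ⟨φ + η, by rw [diracSchwartz_add, schwartz_toLp_add, schwartz_toLp_add]; rfl⟩
  zero_mem' := ⟨0, by
    rw [← zero_smul ℂ (0 : 𝓢(Plane, Spinor)), diracSchwartz_smul, schwartz_toLp_smul,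
      schwartz_toLp_smul, zero_smul, zero_smul]; rfl⟩
  smul_mem' := by
    rintro c _ ⟨φ, rfl⟩
    exact ⟨c • φ, by rw [diracSchwartz_smul, schwartz_toLp_smul, schwartz_toLp_smul]; rfl⟩

theorem eq_zero_of_inner_diracSchwartz {c : ℂ} (hc : c * c = -1) (z : State)
    (h : ∀ φ : 𝓢(Plane, Spinor),
      inner ℂ (((diracSchwartz φ).toLp 2 : State) + c • (φ.toLp 2 : State)) z = 0) : z = 0 := by
  have hdense : DenseRange (SchwartzMap.toLpCLM ℝ Spinor 2 (volume : Measure Plane)) :=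
    SchwartzMap.denseRange_toLpCLM (by norm_num)
  refine Dense.eq_zero_of_inner_right (𝕜 := ℂ) hdense ?_
  rintro _ ⟨η, rfl⟩
  obtain ⟨φ, rfl⟩ := exists_diracSchwartz_add_smul_eq hc η
  rw [SchwartzMap.toLpCLM_apply, schwartz_toLp_add, schwartz_toLp_smul]
  exact h φ

/-- The Dirac operator on its maximal domain is self-adjoint. -/
theorem isSelfAdjointGraph_dirac : IsSelfAdjointGraph dirac.graph := by
  rw [dirac_graph]
  refine isSelfAdjointGraph_of_dense_range (Γ₀ := diracSchwartzGraph) (fun x y => ⟨?_, ?_⟩) ?_ ?_ ?_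
  · rintro h _ _ ⟨φ, hφ⟩
    obtain ⟨rfl, rfl⟩ := Prod.mk.inj hφ
    exact h φ
  · exact fun h φ => h _ _ ⟨φ, rfl⟩
  · rintro _ ⟨φ, rfl⟩ η
    exact inner_toLp_diracSchwartz η φ
  · exact fun z hz => eq_zero_of_inner_diracSchwartz Complex.I_mul_I z fun φ => hz _ _ ⟨φ, rfl⟩
  · refine fun z hz => eq_zero_of_inner_diracSchwartz (c := -Complex.I) (by simp) z fun φ => ?_
    rw [neg_smul, ← sub_eq_add_neg]
    exact hz _ _ ⟨φ, rfl⟩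

end Dirac

/-! ### Self-adjointness of the truncated Floquet Hamiltonian -/

section Replica

variable (B : State →L[ℂ] State) (ε : ℝ) {S : Set ℤ}

/-- The nearest-neighbour coupling `ε B φ_{n+1} + ε B* φ_{n-1}` of the modes in `S`. -/
noncomputable def hopping (φ : S → State) (n : ℤ) : State :=
  (ε : ℂ) • B (extendZero S φ (n + 1)) +
    (ε : ℂ) • ContinuousLinearMap.adjoint B (extendZero S φ (n - 1))

theorem extendZero_coe (φ : S → State) (m : S) : extendZero S φ m = φ m := by
  simp [extendZero]

theorem extendZero_of_mem (φ : S → State) {m : ℤ} (h : m ∈ S) : extendZero S φ m = φ ⟨m, h⟩ := by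
  simp [extendZero, h]

theorem extendZero_of_notMem (φ : S → State) {m : ℤ} (h : m ∉ S) : extendZero S φ m = 0 := by
  simp [extendZero, h]

theorem embed_apply (φ : Modes S) (n : ℤ) : (embed S φ) n = extendZero S φ n := rfl

theorem embed_single (m : S) (a : State) :
    embed S (lp.single 2 m a) = lp.single 2 (m : ℤ) a := by
  ext1
  funext n
  rw [embed_apply, lp.single_apply]
  by_cases h : n ∈ S
  · rw [extendZero_of_mem _ h, lp.single_apply]
    by_cases hnm : n = m
    · subst hnm
      simp
    · rw [Pi.single_eq_of_ne hnm, Pi.single_eq_of_ne fun h => hnm (congrArg Subtype.val h)]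
  · rw [extendZero_of_notMem _ h, Pi.single_eq_of_ne (by rintro rfl; exact h m.2)]

theorem adjoint_embed_apply (χ : Modes ℤ) (m : S) :
    (ContinuousLinearMap.adjoint (embed S).toContinuousLinearMap χ) m = χ m := by
  refine ext_inner_left ℂ fun a => ?_
  refine (lp.inner_single_left (𝕜 := ℂ) (G := fun _ : S => State) m a _).symm.trans ?_
  rw [ContinuousLinearMap.adjoint_inner_right]
  refine (congrArg (inner ℂ · χ) (embed_single m a)).trans ?_
  exact lp.inner_single_left (𝕜 := ℂ) (G := fun _ : ℤ => State) (m : ℤ) a χ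

variable {B ε}

theorem mem_dirac_graph {x y : State} :
    (x, y) ∈ dirac.graph ↔ ∃ h : x ∈ dirac.domain, dirac ⟨x, h⟩ = y := by
  rw [LinearPMap.mem_graph_iff]
  constructor
  · rintro ⟨⟨u, hu⟩, rfl, h⟩
    exact ⟨hu, h⟩
  · rintro ⟨hx, h⟩
    exact ⟨⟨x, hx⟩, rfl, h⟩

theorem mem_floquet_graph {φ χ : Modes ℤ} : (φ, χ) ∈ (floquet B ε).graph ↔ ∀ n : ℤ,
    (φ n, χ n - ((n : ℂ) • φ n + ((ε : ℂ) • B (φ (n + 1)) +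
      (ε : ℂ) • ContinuousLinearMap.adjoint B (φ (n - 1))))) ∈ dirac.graph := by
  rw [floquet_graph]
  refine forall_congr' fun n => ?_
  rw [mem_dirac_graph]
  refine exists_congr fun h => ?_
  constructor
  · intro e
    simp only at e
    rw [e]
    abel
  · intro e
    change χ n = (n : ℂ) • φ n + dirac ⟨φ n, h⟩ + _ + _
    rw [e]
    abel

theorem memℓp_of_finite_support {f : ℤ → State} (hf : f.support.Finite) : Memℓp f 2 := by
  refine memℓp_gen (summable_of_hasFiniteSupport (hf.subset fun n hn => ?_))
  intro h0
  exact hn (by simp [h0])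

/-- The action of the truncated Floquet Hamiltonian, mode by mode. -/
theorem mem_replica_graph [Finite S] {x y : Modes S} : (x, y) ∈ (replica B ε S).graph ↔ ∀ m : S,
    (x m, y m - (((m : ℤ) : ℂ) • x m + hopping B ε x m)) ∈ dirac.graph := by
  rw [LinearPMap.mem_graph_iff]
  constructor
  · rintro ⟨⟨u, hu⟩, rfl, hy⟩ m
    have h1 := mem_floquet_graph.1 ((floquet B ε).mem_graph ⟨embed S u, hu⟩) m
    have h2 : y m = (floquet B ε ⟨embed S u, hu⟩ : Modes ℤ) m := by
      rw [← show replica B ε S ⟨u, hu⟩ = y from hy]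
      exact adjoint_embed_apply _ m
    rw [h2, ← extendZero_coe u m]
    exact h1
  · intro h
    -- The full operator also fills modes just outside `S` by hopping. Adding them to `y` gives the
    -- image of the extension of `x`; its support is finite because `S` is.
    let f : ℤ → State := fun n => extendZero S y n + Sᶜ.indicator (hopping B ε x) n
    have hfin : f.support.Finite := by
      have hS : S.Finite := S.toFinite
      refine ((hS.union (hS.image (· - 1))).union (hS.image (· + 1))).subset fun n hn => ?_
      by_contra hcon
      simp only [Set.mem_union, Set.mem_image, not_or, not_exists, not_and] at hcon
      obtain ⟨⟨h1, h2⟩, h3⟩ := hcon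
      refine hn ?_
      have h2' : n + 1 ∉ S := fun h => h2 _ h (by ring)
      have h3' : n - 1 ∉ S := fun h => h3 _ h (by ring)
      simp [f, hopping, extendZero_of_notMem, h1, h2', h3']
    have hg : (embed S x, (⟨f, memℓp_of_finite_support hfin⟩ : Modes ℤ)) ∈ (floquet B ε).graph := by
      refine mem_floquet_graph.2 fun n => ?_
      change (extendZero S x n, f n - ((n : ℂ) • extendZero S x n + hopping B ε x n)) ∈ dirac.graph
      by_cases hn : n ∈ S
      · have h1 := h ⟨n, hn⟩
        simpa [f, hn, extendZero_of_mem] using h1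
      · have e : f n - ((n : ℂ) • extendZero S x n + hopping B ε x n) = 0 := by
          simp [f, hn, extendZero_of_notMem]
        rw [e, extendZero_of_notMem _ hn]
        exact dirac.graph.zero_mem
    obtain ⟨⟨z, hz⟩, hzx, hzy⟩ := (LinearPMap.mem_graph_iff _).1 hg
    obtain rfl : z = embed S x := hzx
    refine ⟨⟨x, hz⟩, rfl, ?_⟩
    ext1
    funext m
    change (ContinuousLinearMap.adjoint (embed S).toContinuousLinearMap
      (floquet B ε ⟨embed S x, hz⟩)) m = y m
    rw [adjoint_embed_apply, hzy]
    simp [f, extendZero_coe]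

theorem inner_adjoint_shift (φ χ : S → State) :
    ∑' n : ℤ, inner ℂ (B (extendZero S φ (n + 1))) (extendZero S χ n) =
      ∑' n : ℤ, inner ℂ (extendZero S φ n)
        (ContinuousLinearMap.adjoint B (extendZero S χ (n - 1))) := by
  refine Eq.trans ?_ ((Equiv.addRight (1 : ℤ)).tsum_eq _)
  refine tsum_congr fun n => ?_
  simp [ContinuousLinearMap.adjoint_inner_right]

/-- Extension by zero turns both sides into sums over `ℤ`, where an index shift exchanges the `B`
and `B*` terms; the edges of `S` contribute nothing. -/
theorem sum_inner_hopping [Fintype S] (φ χ : S → State) :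
    ∑ m : S, inner ℂ (hopping B ε φ m) (χ m) = ∑ m : S, inner ℂ (φ m) (hopping B ε χ m) := by
  have hS : S.Finite := S.toFinite
  have hfin : ∀ g : ℤ → ℂ, (∀ n ∉ S, g n = 0) → Summable g := fun g hg =>
    summable_of_hasFiniteSupport (hS.subset fun n hn => by
      by_contra h
      exact hn (hg n h))
  have hsum : ∀ g : ℤ → ℂ, (∀ n ∉ S, g n = 0) → ∑ m : S, g m = ∑' n, g n := fun g hg => by
    rw [← tsum_fintype (L := .unconditional _)]
    exact tsum_subtype_eq_of_support_subset fun n hn => by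
      by_contra h
      exact hn (hg n h)
  have e1 := hsum (fun n => inner ℂ (hopping B ε φ n) (extendZero S χ n))
    (fun n hn => by simp [extendZero_of_notMem _ hn])
  have e2 := hsum (fun n => inner ℂ (extendZero S φ n) (hopping B ε χ n))
    (fun n hn => by simp [extendZero_of_notMem _ hn])
  simp only [extendZero_coe] at e1 e2
  rw [e1, e2]
  simp only [hopping, inner_add_left, inner_add_right, inner_smul_left, inner_smul_right,
    Complex.conj_ofReal]
  rw [Summable.tsum_add, Summable.tsum_add, tsum_mul_left, tsum_mul_left, tsum_mul_left,
    tsum_mul_left, inner_adjoint_shift, add_comm]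
  · congr 2
    have h := congrArg (starRingEnd ℂ) (inner_adjoint_shift (B := B) χ φ)
    rw [Complex.conj_tsum, Complex.conj_tsum] at h
    simpa only [inner_conj_symm] using h.symm
  all_goals
    refine hfin _ fun n hn => ?_
    simp [extendZero_of_notMem _ hn]

theorem inner_modes_eq_sum [Fintype S] (x y : Modes S) :
    inner ℂ x y = ∑ m : S, inner ℂ (x m) (y m) := by
  rw [lp.inner_eq_tsum, tsum_fintype]

/-- The pairs `(e_k ⊗ φ, Ĥ_S (e_k ⊗ φ))`. -/
theorem single_mem_replica_graph [Finite S] (k : S) {φ η : State} (h : (φ, η) ∈ dirac.graph) :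
    ((lp.single 2 k φ : Modes S), (⟨fun m => hopping B ε (lp.single 2 k φ : Modes S) m +
      (lp.single 2 k (((k : ℤ) : ℂ) • φ + η) : Modes S) m, Memℓp.all _⟩ : Modes S)) ∈
      (replica B ε S).graph := by
  refine mem_replica_graph.2 fun m => ?_
  by_cases hmk : m = k
  · subst hmk
    change ((lp.single 2 m φ : Modes S) m, (hopping B ε (lp.single 2 m φ : Modes S) m +
      (lp.single 2 m (((m : ℤ) : ℂ) • φ + η) : Modes S) m) - (((m : ℤ) : ℂ) •
        (lp.single 2 m φ : Modes S) m + hopping B ε (lp.single 2 m φ : Modes S) m)) ∈ dirac.graph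
    rw [lp.single_apply_self, lp.single_apply_self, add_comm (hopping _ _ _ _), add_sub_add_right_eq_sub,
      add_sub_cancel_left]
    exact h
  · simp only [lp.single_apply, Pi.single_eq_of_ne hmk, smul_zero, zero_add, add_zero, sub_self]
    exact dirac.graph.zero_mem

/-- The truncated Floquet Hamiltonian is self-adjoint. -/
theorem isSelfAdjointGraph_replica [Finite S] : IsSelfAdjointGraph (replica B ε S).graph := by
  have := Fintype.ofFinite S
  intro x y
  constructor
  · intro h u v huv
    rw [mem_replica_graph] at h huv
    rw [inner_modes_eq_sum, inner_modes_eq_sum]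
    have h1 : ∀ m : S, inner ℂ (v m) (x m) - inner ℂ (hopping B ε u m) (x m) =
        inner ℂ (u m) (y m) - inner ℂ (u m) (hopping B ε x m) := fun m => by
      have := isSelfAdjointGraph_dirac.inner_eq (h m) (huv m)
      simp only [inner_sub_left, inner_sub_right, inner_add_left, inner_add_right, inner_smul_left,
        inner_smul_right, map_intCast] at this
      linear_combination this
    have h2 := Finset.sum_congr (s₁ := Finset.univ) rfl fun m _ => h1 m
    rw [Finset.sum_sub_distrib, Finset.sum_sub_distrib, sum_inner_hopping] at h2
    exact sub_left_injective h2
  · intro h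
    -- Testing against single-mode vectors and moving the symmetric hopping across reduces the claim
    -- to self-adjointness of the Dirac operator in mode `k`.
    refine mem_replica_graph.2 fun k => (isSelfAdjointGraph_dirac _ _).2 fun φ η hφ => ?_
    have h1 := h _ _ (single_mem_replica_graph (B := B) (ε := ε) k hφ)
    rw [lp.inner_single_left, inner_modes_eq_sum] at h1
    simp only [inner_add_left, Finset.sum_add_distrib] at h1
    rw [sum_inner_hopping, ← inner_modes_eq_sum, lp.inner_single_left] at h1
    have h2 : ∑ m : S, inner ℂ ((lp.single 2 k φ : Modes S) m) (hopping B ε x m) =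
        inner ℂ φ (hopping B ε x k) := by
      rw [Finset.sum_eq_single k]
      · rw [lp.single_apply_self]
      · intro m _ hm
        rw [lp.single_apply_ne _ _ _ hm, inner_zero_left]
      · simp
    rw [h2, inner_add_left, inner_smul_left, map_intCast] at h1
    rw [inner_sub_right, inner_add_right, inner_smul_right, ← h1]
    ring

end Replica

/-! ### The periodic drive and well-posedness -/

section Driving

variable {B : State →L[ℂ] State} {ε : ℝ}

/-- The bounded time-periodic part of the driven Hamiltonian. -/
noncomputable def driving (B : State →L[ℂ] State) (ε τ : ℝ) : State →L[ℂ] State :=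
  (ε : ℂ) • (Complex.exp (-(Complex.I * τ)) • B +
    Complex.exp (Complex.I * τ) • ContinuousLinearMap.adjoint B)

theorem driving_apply (τ : ℝ) (x : State) : driving B ε τ x =
    (ε : ℂ) • (Complex.exp (-(Complex.I * τ)) • B x +
      Complex.exp (Complex.I * τ) • ContinuousLinearMap.adjoint B x) := rfl

theorem conj_exp_I_mul (τ : ℝ) :
    (starRingEnd ℂ) (Complex.exp (Complex.I * τ)) = Complex.exp (-(Complex.I * τ)) := by
  rw [← Complex.exp_conj]; simp

theorem conj_exp_neg_I_mul (τ : ℝ) :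
    (starRingEnd ℂ) (Complex.exp (-(Complex.I * τ))) = Complex.exp (Complex.I * τ) := by
  rw [← Complex.exp_conj]; simp

theorem norm_exp_I_mul_real (τ : ℝ) : ‖Complex.exp (Complex.I * τ)‖ = 1 := by
  rw [mul_comm, Complex.norm_exp_ofReal_mul_I]

theorem norm_exp_neg_I_mul_real (τ : ℝ) : ‖Complex.exp (-(Complex.I * τ))‖ = 1 := by
  rw [← conj_exp_I_mul, Complex.norm_conj, norm_exp_I_mul_real]

theorem inner_driving (τ : ℝ) (x y : State) :
    inner ℂ (driving B ε τ x) y = inner ℂ x (driving B ε τ y) := by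
  simp only [driving_apply, inner_smul_left, inner_smul_right, inner_add_left, inner_add_right,
    Complex.conj_ofReal, conj_exp_I_mul, conj_exp_neg_I_mul,
    ContinuousLinearMap.adjoint_inner_left, ContinuousLinearMap.adjoint_inner_right]
  ring

theorem norm_exp_sub_exp_le (s t : ℝ) :
    ‖Complex.exp (Complex.I * s) - Complex.exp (Complex.I * t)‖ ≤ |s - t| := by
  have e : Complex.exp (Complex.I * s) - Complex.exp (Complex.I * t) =
      Complex.exp (Complex.I * t) * (Complex.exp (Complex.I * ((s - t : ℝ) : ℂ)) - 1) := by
    rw [mul_sub, ← Complex.exp_add, mul_one]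
    congr 2
    push_cast
    ring
  rw [e, norm_mul, norm_exp_I_mul_real, one_mul]
  exact Real.norm_exp_I_mul_ofReal_sub_one_le

theorem norm_adjoint_eq (B : State →L[ℂ] State) : ‖ContinuousLinearMap.adjoint B‖ = ‖B‖ :=
  LinearIsometryEquiv.norm_map _ _

theorem norm_driving_le (τ : ℝ) : ‖driving B ε τ‖ ≤ |ε| * (‖B‖ + ‖B‖) := by
  rw [driving, norm_smul, Complex.norm_real, Real.norm_eq_abs]
  refine mul_le_mul_of_nonneg_left ((norm_add_le _ _).trans ?_) (abs_nonneg _)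
  rw [norm_smul, norm_smul, norm_exp_I_mul_real, norm_exp_neg_I_mul_real, one_mul, one_mul,
    norm_adjoint_eq]

theorem norm_driving_sub_le (s t : ℝ) :
    ‖driving B ε s - driving B ε t‖ ≤ |ε| * (‖B‖ + ‖B‖) * |s - t| := by
  have e : driving B ε s - driving B ε t = (ε : ℂ) •
      ((Complex.exp (Complex.I * (-s : ℝ)) - Complex.exp (Complex.I * (-t : ℝ))) • B +
        (Complex.exp (Complex.I * s) - Complex.exp (Complex.I * t)) •
          ContinuousLinearMap.adjoint B) := by
    simp only [driving, Complex.ofReal_neg, mul_neg]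
    module
  have h1 := norm_exp_sub_exp_le (-s) (-t)
  rw [neg_sub_neg, abs_sub_comm] at h1
  rw [e, norm_smul, Complex.norm_real, Real.norm_eq_abs, mul_assoc, add_mul]
  refine mul_le_mul_of_nonneg_left ((norm_add_le _ _).trans (add_le_add ?_ ?_)) (abs_nonneg _)
  · rw [norm_smul, mul_comm]
    gcongr
  · rw [norm_smul, mul_comm, norm_adjoint_eq]
    gcongr
    exact norm_exp_sub_exp_le s t

theorem isEvolution_iff_isPropagator {U : ℝ → State →L[ℂ] State} :
    IsEvolution B ε U ↔ IsPropagator dirac (driving B ε) U := by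
  constructor
  · rintro ⟨h0, h⟩
    refine ⟨h0, fun x y hxy t => ?_⟩
    obtain ⟨hx, -⟩ := mem_dirac_graph.1 hxy
    obtain ⟨hd, h1⟩ := h x hx t
    exact ⟨dirac ⟨U t x, hd⟩, mem_dirac_graph.2 ⟨hd, rfl⟩, h1⟩
  · rintro ⟨h0, h⟩
    refine ⟨h0, fun x hx t => ?_⟩
    obtain ⟨z, hz, h1⟩ := h x _ (mem_dirac_graph.2 ⟨hx, rfl⟩) t
    obtain ⟨hd, rfl⟩ := mem_dirac_graph.1 hz
    exact ⟨hd, h1⟩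

theorem existsUnique_isEvolution : ∃! U : ℝ → State →L[ℂ] State, IsEvolution B ε U := by
  simp only [isEvolution_iff_isPropagator]
  obtain ⟨U, hU⟩ := exists_isPropagator isSelfAdjointGraph_dirac inner_driving
    (norm_driving_le (B := B) (ε := ε)) norm_driving_sub_le
  exact ⟨U, hU, fun U' hU' => hU'.unique hU isSelfAdjointGraph_dirac inner_driving⟩

theorem existsUnique_isUnitaryGroup_replica {S : Set ℤ} [Finite S] :
    ∃! G : ℝ → Modes S →L[ℂ] Modes S, IsUnitaryGroup (replica B ε S) G := by
  obtain ⟨G, hG⟩ := exists_isUnitaryGroup (isSelfAdjointGraph_replica (B := B) (ε := ε) (S := S))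
  exact ⟨G, hG, fun G' hG' => hG'.unique isSelfAdjointGraph_replica hG⟩

end Driving

/-! ### Finite-speed bound between modes -/

section Propagation

variable {B : State →L[ℂ] State} {ε : ℝ} {S : Set ℤ}

theorem hasDerivAt_exp_mul_I (c : ℂ) (t : ℝ) :
    HasDerivAt (fun s : ℝ => Complex.exp (c * s)) (c * Complex.exp (c * t)) t := by
  have h1 : HasDerivAt (fun s : ℝ => c * (s : ℂ)) c t := by
    simpa using (Complex.ofRealCLM.hasDerivAt (x := t)).const_mul c
  simpa [mul_comm] using h1.cexp

theorem norm_hopping_le (hε : 0 ≤ ε) {φ : S → State} {n : ℤ} {K : ℝ}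
    (h₁ : ‖extendZero S φ (n + 1)‖ ≤ K) (h₂ : ‖extendZero S φ (n - 1)‖ ≤ K) :
    ‖hopping B ε φ n‖ ≤ 2 * (‖B‖ * ε) * K := by
  have hb : ∀ {D : State →L[ℂ] State} {x : State}, ‖D‖ = ‖B‖ → ‖x‖ ≤ K →
      ‖(ε : ℂ) • D x‖ ≤ ‖B‖ * ε * K := fun {D x} hD hx => by
    rw [norm_smul, Complex.norm_real, Real.norm_eq_abs, abs_of_nonneg hε]
    calc ε * ‖D x‖ ≤ ε * (‖D‖ * ‖x‖) := by gcongr; exact D.le_opNorm x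
      _ ≤ ε * (‖B‖ * K) := by rw [hD]; gcongr
      _ = _ := by ring
  refine (norm_add_le _ _).trans ?_
  linarith [hb rfl h₁, hb (norm_adjoint_eq B) h₂]

/-- Propagation of the truncated dynamics from mode `j` to a mode at distance `k`, for initial data
in the domain. -/
theorem norm_extendZero_apply_single_le_of_mem [Finite S] (hε : 0 ≤ ε)
    {G : ℝ → Modes S →L[ℂ] Modes S} (hG : IsUnitaryGroup (replica B ε S) G) (j : S) {χ η : State}
    (hχ : (χ, η) ∈ dirac.graph) (k : ℕ) (m : ℤ) (hm : (k : ℤ) ≤ |m - j|) {t : ℝ} (ht : 0 ≤ t) :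
    ‖extendZero S (G t (lp.single 2 j χ)) m‖ ≤
      ‖χ‖ * ((2 * (‖B‖ * ε) * t) ^ k / k.factorial) := by
  obtain ⟨T, hT⟩ := exists_isUnitaryGroup isSelfAdjointGraph_dirac
  have hg := single_mem_replica_graph (B := B) (ε := ε) j hχ
  set x : Modes S := lp.single 2 j χ with hx
  -- The mode `m` ranges over all integers, since a neighbour of a mode of `S` may lie outside `S`.
  induction k generalizing m t with
  | zero =>
    by_cases hmS : m ∈ S
    · rw [extendZero_of_mem _ hmS]
      have h1 := lp.norm_apply_le_norm (p := 2) (by norm_num) (G t x) ⟨m, hmS⟩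
      rw [hG.norm_apply, hx, lp.norm_single (by norm_num)] at h1
      simpa using h1
    · rw [extendZero_of_notMem _ hmS, norm_zero]
      positivity
  | succ k ih =>
    by_cases hmS : m ∈ S
    swap
    · rw [extendZero_of_notMem _ hmS, norm_zero]
      positivity
    set p : S := ⟨m, hmS⟩
    have hcomp : ∀ s, HasDerivAt (fun s => (G s x) p)
        (-Complex.I • (G s ⟨fun m => hopping B ε x m +
          (lp.single 2 j (((j : ℤ) : ℂ) • χ + η) : Modes S) m, Memℓp.all _⟩ : Modes S) p) s :=
      fun s => ((lp.evalCLM ℂ (fun _ : S => State) 2 p).restrictScalars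
        ℝ).hasFDerivAt.comp_hasDerivAt s (hG.hasDerivAt hg s)
    have hgr : ∀ s, _ := fun s => mem_replica_graph.1 (hG.apply_mem_graph hg s) p
    set y : ℝ → Modes S := fun s => G s ⟨fun m => hopping B ε x m +
          (lp.single 2 j (((j : ℤ) : ℂ) • χ + η) : Modes S) m, Memℓp.all _⟩
    set e : ℝ → ℂ := fun s => Complex.exp (Complex.I * m * s) with he
    -- Interaction picture in one mode: `e^{ims}` and the backward Dirac group cancel `m + D·σ`
    -- without changing norms, leaving only the hopping.
    have hd : ∀ s, HasDerivAt (fun s => T (-1 * s + 0) (e s • (G s x) p))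
        (T (-1 * s + 0) (e s • (-Complex.I • hopping B ε (G s x) m))) s := fun s => by
      have h1 := (hasDerivAt_exp_mul_I (Complex.I * m) s).smul (hcomp s)
      have h2 := hT.hasDerivAt_apply (-1) 0 h1 (dirac.graph.smul_mem (e s) (hgr s))
      refine HasDerivAt.congr_deriv h2 (congrArg _ ?_)
      simp only [he, p]
      push_cast
      module
    rw [extendZero_of_mem _ hmS]
    have hne : p ≠ j := by
      rintro rfl
      simp [p] at hm
      omega
    have key := norm_le_pow_div_factorial (K := ‖χ‖) (M := 2 * (‖B‖ * ε)) (k := k) (T := t)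
      (f := fun s => T (-1 * s + 0) (e s • (G s x) p)) ?_ (fun s _ _ => hd s) ?_ ht
    · have hen : ‖e t‖ = 1 := by
        have : e t = Complex.exp (Complex.I * ((m * t : ℝ) : ℂ)) := by
          simp only [he]; push_cast; ring_nf
        rw [this, norm_exp_I_mul_real]
      simpa only [hT.norm_apply, norm_smul, hen, one_mul] using key
    · simp [hG.zero, hx, Pi.single_eq_of_ne hne]
    · intro s hs _
      have hes : ‖e s‖ = 1 := by
        have : e s = Complex.exp (Complex.I * ((m * s : ℝ) : ℂ)) := by
          simp only [he]; push_cast; ring_nf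
        rw [this, norm_exp_I_mul_real]
      rw [hT.norm_apply, norm_smul, hes, one_mul, norm_smul, norm_neg, Complex.norm_I, one_mul]
      push_cast at hm
      -- Both neighbours are still at distance at least `k` from `j`.
      refine (norm_hopping_le hε (ih (m + 1) ?_ hs) (ih (m - 1) ?_ hs)).trans_eq (by ring)
      · rcases abs_cases (m - (j : ℤ)) with h | h <;> rcases abs_cases (m + 1 - (j : ℤ)) with h' | h' <;>
          omega
      · rcases abs_cases (m - (j : ℤ)) with h | h <;> rcases abs_cases (m - 1 - (j : ℤ)) with h' | h' <;>
          omega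

/-- Propagation of the truncated dynamics from mode `j` to a mode at distance `k`. -/
theorem norm_apply_single_le [Finite S] (hε : 0 ≤ ε)
    {G : ℝ → Modes S →L[ℂ] Modes S} (hG : IsUnitaryGroup (replica B ε S) G) (j m : S) (χ : State)
    (k : ℕ) (hm : (k : ℤ) ≤ |(m : ℤ) - j|) {t : ℝ} (ht : 0 ≤ t) :
    ‖(G t (lp.single 2 j χ) : Modes S) m‖ ≤
      ‖χ‖ * ((2 * (‖B‖ * ε) * t) ^ k / k.factorial) := by
  have hc : Continuous fun χ : State => block (G t) m j χ := (block (G t) m j).continuous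
  refine (dense_domain_of_isSelfAdjointGraph isSelfAdjointGraph_dirac).induction
    (P := fun χ => ‖block (G t) m j χ‖ ≤ ‖χ‖ * ((2 * (‖B‖ * ε) * t) ^ k / k.factorial)) ?_
    (isClosed_le hc.norm (by fun_prop)) χ
  rintro χ ⟨η, h⟩
  have := norm_extendZero_apply_single_le_of_mem hε hG j h k m hm ht
  rwa [extendZero_coe] at this

end Propagation

/-! ### Fourier modes of the solution and Duhamel's formula -/

section Comparison

theorem hasDerivAt_modes {S : Set ℤ} [Finite S] {f : ℝ → Modes S} {f' : Modes S} {t : ℝ}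
    (h : ∀ m, HasDerivAt (fun s => f s m) (f' m) t) : HasDerivAt f f' t := by
  have := Fintype.ofFinite S
  have hsum : ∀ x : Modes S,
      x = ∑ m, lp.singleContinuousLinearMap ℂ (fun _ : S => State) 2 m (x m) := fun x => by
    have h1 := lp.hasSum_single (E := fun _ : S => State) (p := 2) (by norm_num) x
    exact h1.unique (hasSum_fintype _)
  have h1 := HasDerivAt.fun_sum (u := Finset.univ) fun m _ =>
    ((lp.singleContinuousLinearMap ℂ (fun _ : S => State) 2 m).restrictScalars
      ℝ).hasFDerivAt.comp_hasDerivAt t (h m)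
  rw [hsum f']
  exact h1.congr_of_eventuallyEq (Eventually.of_forall fun s => hsum (f s))

variable {B : State →L[ℂ] State} {ε : ℝ} {U : ℝ → State →L[ℂ] State}

/-- The Fourier phase `e^{-iks}`. -/
noncomputable def phase (k : ℤ) (s : ℝ) : ℂ := Complex.exp (-(Complex.I * k) * s)

theorem norm_phase (k : ℤ) (s : ℝ) : ‖phase k s‖ = 1 := by
  have : phase k s = Complex.exp (Complex.I * ((-(k * s) : ℝ) : ℂ)) := by
    rw [phase]; push_cast; ring_nf
  rw [this, norm_exp_I_mul_real]

theorem phase_smul_driving (k : ℤ) (s : ℝ) (x : State) :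
    phase k s • driving B ε s x = (ε : ℂ) • B (phase (k + 1) s • x) +
      (ε : ℂ) • ContinuousLinearMap.adjoint B (phase (k - 1) s • x) := by
  have h1 : phase (k + 1) s = phase k s * Complex.exp (-(Complex.I * s)) := by
    rw [phase, phase, ← Complex.exp_add]; push_cast; ring_nf
  have h2 : phase (k - 1) s = phase k s * Complex.exp (Complex.I * s) := by
    rw [phase, phase, ← Complex.exp_add]; push_cast; ring_nf
  rw [driving_apply, map_smul, map_smul, h1, h2]
  module

/-- The Fourier modes `e^{-iks} x`, `k ∈ S`, of a state. -/
noncomputable def phaseModes (S : Set ℤ) [Finite S] (s : ℝ) (x : State) : Modes S :=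
  ⟨fun k => phase k s • x, Memℓp.all _⟩

theorem phaseModes_apply (S : Set ℤ) [Finite S] (s : ℝ) (x : State) (k : S) :
    phaseModes S s x k = phase k s • x := rfl

/-- The last mode `n` of `S_n`. -/
def topMode (n : ℕ) : replicaSet n := ⟨n, by simp⟩

/-- The first mode `-n` of `S_n`. -/
def bottomMode (n : ℕ) : replicaSet n := ⟨-n, by simp⟩

/-- Truncation loses the upper neighbour only at the last mode; this locates one of the two sources.
-/
theorem phase_smul_sub_extendZero_add (n : ℕ) (s : ℝ) (x : State) (m : replicaSet n) :
    phase (m + 1) s • x - extendZero (replicaSet n) (phaseModes _ s x) (m + 1) =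
      (lp.single 2 (topMode n) (phase (n + 1) s • x) : Modes (replicaSet n)) m := by
  rw [lp.single_apply]
  obtain ⟨m, hm⟩ := m
  by_cases h : m + 1 ∈ replicaSet n
  · rw [extendZero_of_mem _ h, phaseModes_apply, sub_self, Pi.single_eq_of_ne]
    intro h'
    have : m = n := congrArg Subtype.val h'
    have := h.2
    omega
  · have h' : m = n := by
      by_contra hne
      exact h ⟨by have := hm.1; omega, by have := hm.2; omega⟩
    subst h'
    rw [extendZero_of_notMem _ h, sub_zero]
    exact (Pi.single_eq_same (M := fun _ => State) (topMode n) _).symm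

theorem phase_smul_sub_extendZero_sub (n : ℕ) (s : ℝ) (x : State) (m : replicaSet n) :
    phase (m - 1) s • x - extendZero (replicaSet n) (phaseModes _ s x) (m - 1) =
      (lp.single 2 (bottomMode n) (phase (-n - 1) s • x) : Modes (replicaSet n)) m := by
  rw [lp.single_apply]
  obtain ⟨m, hm⟩ := m
  by_cases h : m - 1 ∈ replicaSet n
  · rw [extendZero_of_mem _ h, phaseModes_apply, sub_self, Pi.single_eq_of_ne]
    intro h'
    have : m = -n := congrArg Subtype.val h'
    have := h.1
    omega
  · have h' : m = -n := by
      by_contra hne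
      exact h ⟨by have := hm.1; omega, by have := hm.2; omega⟩
    subst h'
    rw [extendZero_of_notMem _ h, sub_zero]
    exact (Pi.single_eq_same (M := fun _ => State) (bottomMode n) _).symm

/-- The modes of a solution of the driven equation solve the truncated Floquet equation up to the
couplings that leave `S_n`. -/
theorem exists_hasDerivAt_phaseModes (hU : IsPropagator dirac (driving B ε) U) {x y : State}
    (hxy : (x, y) ∈ dirac.graph) (n : ℕ) (s : ℝ) : ∃ η : Modes (replicaSet n),
      (phaseModes (replicaSet n) s (U s x), η) ∈ (replica B ε (replicaSet n)).graph ∧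
      HasDerivAt (fun s => phaseModes (replicaSet n) s (U s x)) (-Complex.I • η +
        (lp.single 2 (topMode n) (-Complex.I • (ε : ℂ) • B (phase (n + 1) s • U s x)) +
          lp.single 2 (bottomMode n)
            (-Complex.I • (ε : ℂ) • ContinuousLinearMap.adjoint B (phase (-n - 1) s • U s x)))) s := by
  obtain ⟨z, hz, hd⟩ := hU.2 x y hxy s
  refine ⟨⟨fun m => phase m s • ((m : ℂ) • U s x + z) +
    hopping B ε (phaseModes (replicaSet n) s (U s x)) m, Memℓp.all _⟩, ?_, ?_⟩
  · refine mem_replica_graph.2 fun m => ?_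
    convert dirac.graph.smul_mem (phase m s) hz using 1
    refine Prod.ext rfl ?_
    change phase m s • (((m : ℤ) : ℂ) • U s x + z) +
      hopping B ε (phaseModes (replicaSet n) s (U s x)) m - (((m : ℤ) : ℂ) • phase m s • U s x +
        hopping B ε (phaseModes (replicaSet n) s (U s x)) m) = phase m s • z
    module
  · refine hasDerivAt_modes fun m => ?_
    have h1 := (hasDerivAt_exp_mul_I (-(Complex.I * (m : ℤ))) s).smul hd
    refine HasDerivAt.congr_deriv h1 ?_
    change phase m s • -Complex.I • (z + driving B ε s (U s x)) +
      (-(Complex.I * (m : ℤ)) * phase m s) • U s x =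
      -Complex.I • (phase m s • (((m : ℤ) : ℂ) • U s x + z) +
        hopping B ε (phaseModes (replicaSet n) s (U s x)) m) +
      ((lp.single 2 (topMode n) (-Complex.I • (ε : ℂ) • B (phase (n + 1) s • U s x)) :
          Modes (replicaSet n)) m +
        (lp.single 2 (bottomMode n) (-Complex.I • (ε : ℂ) •
          ContinuousLinearMap.adjoint B (phase (-n - 1) s • U s x)) : Modes (replicaSet n)) m)
    have hs : ∀ (j : replicaSet n) (D : State →L[ℂ] State) (v : State),
        (lp.single 2 j (-Complex.I • (ε : ℂ) • D v) : Modes (replicaSet n)) m =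
          -Complex.I • (ε : ℂ) • D ((lp.single 2 j v : Modes (replicaSet n)) m) := fun j D v => by
      by_cases hj : m = j
      · subst hj
        rw [lp.single_apply_self, lp.single_apply_self]
      · rw [lp.single_apply_ne _ _ _ hj, lp.single_apply_ne _ _ _ hj, map_zero, smul_zero, smul_zero]
    -- Written as full minus truncated neighbours, the sources complete the truncated hopping to the
    -- whole drive.
    rw [hs, hs, ← phase_smul_sub_extendZero_add, ← phase_smul_sub_extendZero_sub, map_sub, map_sub]
    have h2 := phase_smul_driving (B := B) (ε := ε) m s (U s x)
    have h3 : phase m s • -Complex.I • (z + driving B ε s (U s x)) =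
        -Complex.I • phase m s • z + -Complex.I • phase m s • driving B ε s (U s x) := by module
    rw [h3, h2, hopping]
    module

theorem replicaEvolution_apply {n : ℕ}
    (G : ℝ → Modes (replicaSet n) →L[ℂ] Modes (replicaSet n)) (τ : ℝ) (x : State) :
    replicaEvolution n G τ x = (G τ (phaseModes (replicaSet n) 0 x)) (zeroMode n) := by
  have h : phaseModes (replicaSet n) 0 x =
      ∑ k, lp.singleContinuousLinearMap ℂ (fun _ : replicaSet n => State) 2 k x := by
    have h1 := lp.hasSum_single (E := fun _ : replicaSet n => State) (p := 2) (by norm_num)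
      (phaseModes (replicaSet n) 0 x)
    refine (h1.unique (hasSum_fintype _)).trans (Finset.sum_congr rfl fun k _ => ?_)
    rw [phaseModes_apply, phase, Complex.ofReal_zero, mul_zero, Complex.exp_zero, one_smul]
    rfl
  rw [h, map_sum]
  change _ = lp.evalCLM ℂ (fun _ : replicaSet n => State) 2 (zeroMode n) _
  rw [map_sum, replicaEvolution, sum_apply]
  rfl

/-- Duhamel in differential form: running the group for time `t` on the modes at time `τ - t`
interpolates from `U(τ)x` to `U_n(τ)x` in the zero component, and only the edge sources drive the
change. -/
theorem norm_evolution_sub_replicaEvolution_apply_le (hε : 0 ≤ ε)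
    (hU : IsPropagator dirac (driving B ε) U) {n : ℕ}
    {G : ℝ → Modes (replicaSet n) →L[ℂ] Modes (replicaSet n)}
    (hG : IsUnitaryGroup (replica B ε (replicaSet n)) G) {τ : ℝ} (hτ : 0 ≤ τ) {x y : State}
    (hxy : (x, y) ∈ dirac.graph) :
    ‖U τ x - replicaEvolution n G τ x‖ ≤
      ‖x‖ * ((2 * (‖B‖ * ε) * τ) ^ (n + 1) / (n + 1).factorial) := by
  choose η hη hd using exists_hasDerivAt_phaseModes hU hxy n
  set r : ℝ → Modes (replicaSet n) := fun s =>
    lp.single 2 (topMode n) (-Complex.I • (ε : ℂ) • B (phase (n + 1) s • U s x)) +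
      lp.single 2 (bottomMode n)
        (-Complex.I • (ε : ℂ) • ContinuousLinearMap.adjoint B (phase (-n - 1) s • U s x)) with hr
  have hd' : ∀ t, HasDerivAt
      (fun t => (G t (phaseModes (replicaSet n) (τ - t) (U (τ - t) x))) (zeroMode n) - U τ x)
      ((G t (-r (τ - t))) (zeroMode n)) t := fun t => by
    have h0 : HasDerivAt (fun t => τ - t) (-1) t := (hasDerivAt_id t).const_sub τ
    have h1 := (hd (τ - t)).scomp t h0
    have h2 := hG.hasDerivAt_apply 1 0 h1 (hη (τ - t))
    simp only [one_mul, add_zero, Complex.ofReal_one, Function.comp_apply] at h2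
    have e : (-1 : ℝ) • (-Complex.I • η (τ - t) + r (τ - t)) - Complex.I • η (τ - t) =
        -r (τ - t) := by module
    have h3 := h2.congr_deriv (congrArg (G t) e)
    exact (((lp.evalCLM ℂ (fun _ : replicaSet n => State) 2 (zeroMode n)).restrictScalars
      ℝ).hasFDerivAt.comp_hasDerivAt t h3).sub_const (U τ x)
  have hUx : ∀ k s, ‖phase k s • U s x‖ ≤ ‖x‖ := fun k s => by
    rw [norm_smul, norm_phase, one_mul]
    exact hU.norm_apply_le isSelfAdjointGraph_dirac inner_driving s x
  have hcoef : ∀ (D : State →L[ℂ] State) k s, ‖D‖ = ‖B‖ →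
      ‖-Complex.I • (ε : ℂ) • D (phase k s • U s x)‖ ≤ ‖B‖ * ε * ‖x‖ := fun D k s hD => by
    rw [norm_smul, norm_neg, Complex.norm_I, one_mul, norm_smul, Complex.norm_real,
      Real.norm_eq_abs, abs_of_nonneg hε]
    calc ε * ‖D (phase k s • U s x)‖ ≤ ε * (‖D‖ * ‖x‖) := by
          gcongr
          exact D.le_opNorm_of_le (hUx k s)
      _ = _ := by rw [hD]; ring
  have key := norm_le_pow_div_factorial (K := ‖x‖) (M := 2 * (‖B‖ * ε)) (k := n) (T := τ) ?_
    (fun t _ _ => hd' t) ?_ hτ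
  · rw [norm_sub_rev, replicaEvolution_apply]
    have hU0 : U 0 x = x := by rw [hU.1]; rfl
    rwa [sub_self, hU0] at key
  · rw [hG.zero, sub_zero]
    change phase ((0 : ℤ)) τ • U τ x - U τ x = 0
    simp [phase]
  · intro t ht _
    rw [map_neg, hr]
    simp only [map_add]
    rw [lp.coeFn_neg, Pi.neg_apply, norm_neg, lp.coeFn_add, Pi.add_apply]
    refine (norm_add_le _ _).trans ?_
    -- Each source is `n` hops from mode `0`. The two coefficients `‖B‖ε‖x‖` add up to the factor
    -- `2‖B‖ε` of the last integration.
    have h1 := norm_apply_single_le hε hG (topMode n) (zeroMode n)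
      (-Complex.I • (ε : ℂ) • B (phase (n + 1) (τ - t) • U (τ - t) x)) n
      (by simp [topMode, zeroMode]) ht
    have h2 := norm_apply_single_le hε hG (bottomMode n) (zeroMode n)
      (-Complex.I • (ε : ℂ) • ContinuousLinearMap.adjoint B (phase (-n - 1) (τ - t) • U (τ - t) x)) n
      (by simp [bottomMode, zeroMode]) ht
    have hP : 0 ≤ (2 * (‖B‖ * ε) * t) ^ n / (n.factorial : ℝ) := by positivity
    have h3 := mul_le_mul_of_nonneg_right (hcoef B (n + 1) (τ - t) rfl) hP
    have h4 := mul_le_mul_of_nonneg_right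
      (hcoef (ContinuousLinearMap.adjoint B) (-n - 1) (τ - t) (norm_adjoint_eq B)) hP
    calc _ ≤ _ := add_le_add (h1.trans h3) (h2.trans h4)
      _ = _ := by ring

theorem norm_evolution_sub_replicaEvolution_le (hε : 0 ≤ ε) (hU : IsEvolution B ε U) {n : ℕ}
    {G : ℝ → Modes (replicaSet n) →L[ℂ] Modes (replicaSet n)}
    (hG : IsUnitaryGroup (replica B ε (replicaSet n)) G) {τ : ℝ} (hτ : 0 ≤ τ) :
    ‖U τ - replicaEvolution n G τ‖ ≤
      (2 * ‖B‖ * ε * τ) ^ (n + 1) / ((n + 1).factorial : ℝ) := by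
  refine ContinuousLinearMap.opNorm_le_bound _ (by positivity) fun x => ?_
  refine (dense_domain_of_isSelfAdjointGraph isSelfAdjointGraph_dirac).induction
    (P := fun x => ‖(U τ - replicaEvolution n G τ) x‖ ≤
      (2 * ‖B‖ * ε * τ) ^ (n + 1) / ((n + 1).factorial : ℝ) * ‖x‖) ?_
    (isClosed_le (by fun_prop) (by fun_prop)) x
  rintro x ⟨y, h⟩
  refine (norm_evolution_sub_replicaEvolution_apply_le hε (isEvolution_iff_isPropagator.1 hU) hG hτ
    h).trans_eq ?_
  ring

end Comparison

end FloquetDirac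

theorem theorem2p1
    (B : State →L[ℂ] State) (ε : ℝ) (hε : 0 < ε) :
    (∃! U : ℝ → State →L[ℂ] State, IsEvolution B ε U) ∧
    (∀ n : ℕ, ∃! G : ℝ → Modes (replicaSet n) →L[ℂ]
        Modes (replicaSet n),
      IsUnitaryGroup (replica B ε (replicaSet n)) G) ∧
    ∀ U : ℝ → State →L[ℂ] State, IsEvolution B ε U →
      ∀ (n : ℕ) (G : ℝ → Modes (replicaSet n) →L[ℂ]
          Modes (replicaSet n)),
        IsUnitaryGroup (replica B ε (replicaSet n)) G →
        ∀ τ : ℝ, 0 ≤ τ →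
          ‖U τ - replicaEvolution n G τ‖ ≤
            2 * (2 * ‖B‖ * ε * τ) ^ (n + 1) / (Nat.factorial (n + 1) : ℝ) := by
  refine ⟨existsUnique_isEvolution, fun n => existsUnique_isUnitaryGroup_replica,
    fun U hU n G hG τ hτ => ?_⟩
  -- The estimate already holds without the leading factor `2`, which is slack.
  refine (norm_evolution_sub_replicaEvolution_le hε.le hU hG hτ).trans ?_
  have h : 0 ≤ (2 * ‖B‖ * ε * τ) ^ (n + 1) / ((n + 1).factorial : ℝ) := by positivity
  rw [mul_div_assoc]
  linarith
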